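/- Let $N$ be a closed (compact, without boundary) connected smooth manifold of dimension $2n+1$ and let $\alpha$ be a contact form on $N$: a smooth nowhere vanishing one-form such that $d\alpha$ is non-degenerate on $\xi_x=\ker\alpha_x$ for every $x\in N$ (equivalently, $\alpha\wedge(d\alpha)^n$ vanishes nowhere). Let $\mathcal G=\mathrm{Cont}_0(N,\xi)$ be the group of those diffeomorphisms $\psi$ of $N$ preserving $\xi$ and its co-orientation (contactomorphisms) that are the endpoint $\psi=\psi_1$ of a smooth isotopy $\{\psi_t\}_{t\in[0,1]}$ of contactomorphisms with $\psi_0=\mathrm{id}$. The contact Hamiltonian of such an isotopy is $H_t=\alpha(Y_t)$, where $Y_t=\frac{d}{dt'}\big|_{t'=t}\psi_{t'}\circ\psi_t^{-1}$. For $\psi\in\mathcal G$ put $$|\psi|_\alpha=\inf\int_0^1\max_N|H_t|\,dt,\qquad |\psi|^{\mathrm{osc}}_\alpha=\inf\int_0^1\bigl(\max_N H_t-\min_N H_t\bigr)\,dt,$$ the infima running over all such isotopies with $\psi_1=\psi$, and for $\phi,\psi\in\mathcal G$ put $d_\alpha(\phi,\psi)=|\psi\phi^{-1}|_\alpha$.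 Let $R$ be the Reeb vector field of $\alpha$, determined by $\alpha(R)=1$ and $\iota_R d\alpha=0$, let $\phi_R^t$ be its flow, and let $\mathcal R=\{\phi_R^t : t\in\mathbb R\}\subset\mathcal G$. Then for every $\psi\in\mathcal G$, $|\psi|^{\mathrm{osc}}_\alpha=0$ if and only if $\psi$ belongs to the closure $\overline{\mathcal R}$ of $\mathcal R\subset\mathcal G$ in the topology defined by $d_\alpha$. -/

import Mathlib

open Set Bundle Topology
open scoped Manifold ContDiff

noncomputable section

/-! ### The group of diffeomorphisms -/

section DiffGroup

variable {m : ℕ} {N : Type*} [TopologicalSpace N] [ChartedSpace (EuclideanSpace ℝ (Fin m)) N]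

/-- Smooth self-diffeomorphisms of an `m`-manifold form a group under composition. -/
instance diffeoGroup : Group (Diffeomorph (𝓡 m) (𝓡 m) N N ∞) where
  mul φ ψ := ψ.trans φ
  one := Diffeomorph.refl (𝓡 m) N ∞
  inv φ := φ.symm
  mul_assoc _ _ _ := rfl
  one_mul _ := Diffeomorph.ext fun _ => rfl
  mul_one _ := Diffeomorph.ext fun _ => rfl
  inv_mul_cancel φ := φ.self_trans_symm

theorem diffeo_mul_apply (φ ψ : Diffeomorph (𝓡 m) (𝓡 m) N N ∞) (x : N) :
    (φ * ψ) x = φ (ψ x) := rfl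

theorem diffeo_coe_mul (φ ψ : Diffeomorph (𝓡 m) (𝓡 m) N N ∞) :
    ⇑(φ * ψ) = φ ∘ ψ := rfl

theorem diffeo_one_apply (x : N) :
    (1 : Diffeomorph (𝓡 m) (𝓡 m) N N ∞) x = x := rfl

theorem diffeo_coe_one : ⇑(1 : Diffeomorph (𝓡 m) (𝓡 m) N N ∞) = id := rfl

theorem diffeo_inv_eq_symm (φ : Diffeomorph (𝓡 m) (𝓡 m) N N ∞) : φ⁻¹ = φ.symm := rfl

end DiffGroup

/-! ### One-forms and contact forms -/

/-- The exterior derivative at `x` of a one-form `α` on an `m`-manifold: read `α` in the chart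
at `x` (that is, pull it back by the inverse of the chart), take the exterior derivative there, and
pull the result back by the differential of the chart. -/
def oneFormExtDeriv {m : ℕ} {N : Type*} [TopologicalSpace N]
    [ChartedSpace (EuclideanSpace ℝ (Fin m)) N]
    (α : ∀ x : N, TangentSpace (𝓡 m) x →L[ℝ] ℝ) (x : N) (u v : TangentSpace (𝓡 m) x) : ℝ :=
  extDeriv
    (fun y : EuclideanSpace ℝ (Fin m) =>
      ContinuousAlternatingMap.ofSubsingleton ℝ (EuclideanSpace ℝ (Fin m)) ℝ (0 : Fin 1)
        ((α ((extChartAt (𝓡 m) x).symm y)).comp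
          (mfderiv 𝓘(ℝ, EuclideanSpace ℝ (Fin m)) (𝓡 m) (extChartAt (𝓡 m) x).symm y)))
    (extChartAt (𝓡 m) x x)
    ![mfderiv (𝓡 m) 𝓘(ℝ, EuclideanSpace ℝ (Fin m)) (extChartAt (𝓡 m) x) x u,
      mfderiv (𝓡 m) 𝓘(ℝ, EuclideanSpace ℝ (Fin m)) (extChartAt (𝓡 m) x) x v]

/-- A contact form on a manifold `N` of dimension `2n+1`: a smooth nowhere vanishing one-form `α`
(a smooth section of the cotangent bundle) such that `dα` is non-degenerate on the hyperplane
`ker α` at every point. It determines the co-oriented contact structure `ker α`. -/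
structure ContactForm (n : ℕ) (N : Type*) [TopologicalSpace N]
    [ChartedSpace (EuclideanSpace ℝ (Fin (2 * n + 1))) N]
    [IsManifold (𝓡 (2 * n + 1)) ∞ N] where
  form : ∀ x : N, TangentSpace (𝓡 (2 * n + 1)) x →L[ℝ] ℝ
  smooth : ContMDiff (𝓡 (2 * n + 1))
    ((𝓡 (2 * n + 1)).prod 𝓘(ℝ, EuclideanSpace ℝ (Fin (2 * n + 1)) →L[ℝ] ℝ)) ∞
    (fun x => TotalSpace.mk' (EuclideanSpace ℝ (Fin (2 * n + 1)) →L[ℝ] ℝ)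
      (E := fun x : N => TangentSpace (𝓡 (2 * n + 1)) x →L[ℝ] Bundle.Trivial N ℝ x) x (form x))
  ne_zero : ∀ x, form x ≠ 0
  nondegenerate : ∀ x (u : TangentSpace (𝓡 (2 * n + 1)) x), form x u = 0 →
    (∀ v, form x v = 0 → oneFormExtDeriv form x u v = 0) → u = 0

/-- At every point `dα` is an alternating bilinear form. -/
theorem oneFormExtDeriv_bilin {m : ℕ} {N : Type*} [TopologicalSpace N]
    [ChartedSpace (EuclideanSpace ℝ (Fin m)) N]
    (α : ∀ x : N, TangentSpace (𝓡 m) x →L[ℝ] ℝ) (x : N) :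
    ∃ B : TangentSpace (𝓡 m) x →ₗ[ℝ] TangentSpace (𝓡 m) x →ₗ[ℝ] ℝ,
      (∀ u v, B u v = oneFormExtDeriv α x u v) ∧ ∀ u, B u u = 0 := by
  have key : ∀ η : (EuclideanSpace ℝ (Fin m)) [⋀^Fin 2]→L[ℝ] ℝ,
      ∃ B : EuclideanSpace ℝ (Fin m) →ₗ[ℝ] EuclideanSpace ℝ (Fin m) →ₗ[ℝ] ℝ,
        (∀ u v, B u v = η ![u, v]) ∧ ∀ u, B u u = 0 := by
    intro η
    have add1 : ∀ a b c, η ![a + b, c] = η ![a, c] + η ![b, c] := fun a b c =>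
      η.toAlternatingMap.map_vecCons_add ![c] a b
    have smul1 : ∀ (r : ℝ) a c, η ![r • a, c] = r • η ![a, c] := fun r a c =>
      η.toAlternatingMap.map_vecCons_smul ![c] r a
    have self : ∀ a, η ![a, a] = 0 := fun a =>
      η.map_eq_zero_of_eq ![a, a] (i := 0) (j := 1) rfl (by decide)
    have swap : ∀ a b, η ![a, b] = -η ![b, a] := by
      intro a b
      have h := η.toAlternatingMap.map_swap ![b, a] (i := 0) (j := 1) (by decide)
      have e : (![b, a] ∘ Equiv.swap (0 : Fin 2) 1) = ![a, b] := by
        funext i; fin_cases i <;> simp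
      rw [e] at h
      exact h
    refine ⟨LinearMap.mk₂ ℝ (fun u v => η ![u, v]) add1 smul1 ?_ ?_, fun _ _ => rfl, self⟩
    · intro a b c
      rw [swap a, add1, swap a b, swap a c]; ring
    · intro r a b
      rw [swap a, smul1, swap a b]; simp
  obtain ⟨B, hB, hB'⟩ := key (extDeriv
    (fun y : EuclideanSpace ℝ (Fin m) =>
      ContinuousAlternatingMap.ofSubsingleton ℝ (EuclideanSpace ℝ (Fin m)) ℝ (0 : Fin 1)
        ((α ((extChartAt (𝓡 m) x).symm y)).comp
          (mfderiv 𝓘(ℝ, EuclideanSpace ℝ (Fin m)) (𝓡 m) (extChartAt (𝓡 m) x).symm y)))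
    (extChartAt (𝓡 m) x x))
  let T : TangentSpace (𝓡 m) x →ₗ[ℝ] EuclideanSpace ℝ (Fin m) :=
    (mfderiv (𝓡 m) 𝓘(ℝ, EuclideanSpace ℝ (Fin m)) (extChartAt (𝓡 m) x) x).toLinearMap
  exact ⟨B.compl₁₂ T T, fun u v => hB (T u) (T v), fun u => hB' (T u)⟩

namespace ContactForm

variable {n : ℕ} {N : Type*} [TopologicalSpace N]
  [ChartedSpace (EuclideanSpace ℝ (Fin (2 * n + 1))) N] [IsManifold (𝓡 (2 * n + 1)) ∞ N]

/-- The contact hyperplane `ξ_x = ker α_x`. -/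
def contactPlane (α : ContactForm n N) (x : N) : Submodule ℝ (TangentSpace (𝓡 (2 * n + 1)) x) :=
  LinearMap.ker (α.form x).toLinearMap

/-! ### The Reeb flow -/

/-- At every point there is exactly one vector `v` with `α(v) = 1` and `ι_v dα = 0`. -/
theorem existsUnique_reeb (α : ContactForm n N) (x : N) :
    ∃! v : TangentSpace (𝓡 (2 * n + 1)) x,
      α.form x v = 1 ∧ ∀ w, oneFormExtDeriv α.form x v w = 0 := by
  obtain ⟨B, hB, hB0⟩ := oneFormExtDeriv_bilin α.form x
  have hnd := α.nondegenerate x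
  simp only [← hB] at hnd ⊢
  have hfin : FiniteDimensional ℝ (TangentSpace (𝓡 (2 * n + 1)) x) :=
    inferInstanceAs (FiniteDimensional ℝ (EuclideanSpace ℝ (Fin (2 * n + 1))))
  let K := α.contactPlane x
  let f : K →ₗ[ℝ] Module.Dual ℝ K := B.domRestrict₁₂ K K
  have hf : Function.Injective f := by
    rw [← LinearMap.ker_eq_bot, LinearMap.ker_eq_bot']
    intro u hu
    have := hnd u.1 u.2 fun v hv => LinearMap.congr_fun hu ⟨v, hv⟩
    exact Subtype.ext this
  have hfs : Function.Surjective f :=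
    (LinearMap.injective_iff_surjective_of_finrank_eq_finrank
      (Subspace.dual_finrank_eq (K := ℝ) (V := K)).symm).1 hf
  obtain ⟨u₀, hu₀⟩ : ∃ u, α.form x u ≠ 0 := by
    by_contra! h
    exact α.ne_zero x (ContinuousLinearMap.ext h)
  obtain ⟨u, hu⟩ : ∃ u, α.form x u = 1 :=
    ⟨(α.form x u₀)⁻¹ • u₀, by rw [map_smul, smul_eq_mul, inv_mul_cancel₀ hu₀]⟩
  obtain ⟨w, hw⟩ := hfs ((B u).comp K.subtype)
  have hαw : α.form x w.1 = 0 := w.2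
  have hv1 : α.form x (u - w.1) = 1 := by rw [map_sub, hu, hαw, sub_zero]
  have hvK : ∀ z, α.form x z = 0 → B (u - w.1) z = 0 := by
    intro z hz
    have : B w.1 z = B u z := LinearMap.congr_fun hw ⟨z, hz⟩
    rw [map_sub, LinearMap.sub_apply, this, sub_self]
  refine ⟨u - w.1, ⟨hv1, fun z => ?_⟩, ?_⟩
  · have h1 := hvK (z - α.form x z • (u - w.1)) (by
      rw [map_sub, map_smul, hv1, smul_eq_mul, mul_one, sub_self])
    rw [map_sub (B (u - w.1)), map_smul (B (u - w.1)), hB0, smul_zero, sub_zero] at h1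
    exact h1
  · rintro v ⟨h1, h2⟩
    have : v - (u - w.1) = 0 := hnd _ (by rw [map_sub, h1, hv1, sub_self]) fun z hz => by
      rw [map_sub, LinearMap.sub_apply, h2, hvK z hz, sub_self]
    exact sub_eq_zero.1 this

/-- The Reeb vector field of `α`: `α(R) = 1` and `ι_R dα = 0`. -/
def reebField (α : ContactForm n N) (x : N) : TangentSpace (𝓡 (2 * n + 1)) x :=
  (α.existsUnique_reeb x).choose

theorem reebField_spec (α : ContactForm n N) (x : N) :
    α.form x (α.reebField x) = 1 ∧ ∀ w, oneFormExtDeriv α.form x (α.reebField x) w = 0 :=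
  (α.existsUnique_reeb x).choose_spec.1

/-! ### Contactomorphisms and contact isotopies -/

/-- `ψ` is a contactomorphism: `ψ_* ξ = ξ`, and `ψ` preserves the co-orientation of `ξ`. -/
def IsContactomorphism (α : ContactForm n N)
    (ψ : Diffeomorph (𝓡 (2 * n + 1)) (𝓡 (2 * n + 1)) N N ∞) : Prop :=
  ∀ x : N,
    (α.contactPlane x).map
        (mfderiv (𝓡 (2 * n + 1)) (𝓡 (2 * n + 1)) ψ x).toLinearMap = α.contactPlane (ψ x) ∧
    ∀ v, 0 < α.form x v →
      0 < α.form (ψ x) (mfderiv (𝓡 (2 * n + 1)) (𝓡 (2 * n + 1)) ψ x v)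

/-- An isotopy `{ψ_t}`, `t ∈ [0,1]`, of contactomorphisms with `ψ_0 = 1`, smooth in
`(t, x) ∈ [0,1] × N`. The values of `toFun t` for `t ∉ [0,1]` are irrelevant. -/
structure ContactIsotopy (α : ContactForm n N) where
  toFun : ℝ → Diffeomorph (𝓡 (2 * n + 1)) (𝓡 (2 * n + 1)) N N ∞
  zero : toFun 0 = 1
  contact : ∀ t ∈ Icc (0 : ℝ) 1, α.IsContactomorphism (toFun t)
  smooth : ContMDiffOn (𝓘(ℝ).prod (𝓡 (2 * n + 1))) (𝓡 (2 * n + 1)) ∞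
    (fun p : ℝ × N => toFun p.1 p.2) (Icc (0 : ℝ) 1 ×ˢ univ)

theorem isContactomorphism_one (α : ContactForm n N) : α.IsContactomorphism 1 := by
  intro x
  rw [diffeo_coe_one, mfderiv_id]
  exact ⟨Submodule.map_id _, fun v hv => hv⟩

theorem IsContactomorphism.mul {α : ContactForm n N}
    {φ ψ : Diffeomorph (𝓡 (2 * n + 1)) (𝓡 (2 * n + 1)) N N ∞}
    (hφ : α.IsContactomorphism φ) (hψ : α.IsContactomorphism ψ) :
    α.IsContactomorphism (φ * ψ) := by
  intro x
  have hc : mfderiv (𝓡 (2 * n + 1)) (𝓡 (2 * n + 1)) (φ * ψ) x =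
      (mfderiv (𝓡 (2 * n + 1)) (𝓡 (2 * n + 1)) φ (ψ x)).comp
        (mfderiv (𝓡 (2 * n + 1)) (𝓡 (2 * n + 1)) ψ x) :=
    mfderiv_comp x (φ.mdifferentiable (by simp) _) (ψ.mdifferentiable (by simp) _)
  rw [hc]
  refine ⟨?_, fun v hv => (hφ (ψ x)).2 _ ((hψ x).2 v hv)⟩
  have h := (hφ (ψ x)).1
  rw [← (hψ x).1, ← Submodule.map_comp] at h
  exact h

theorem IsContactomorphism.inv {α : ContactForm n N}
    {ψ : Diffeomorph (𝓡 (2 * n + 1)) (𝓡 (2 * n + 1)) N N ∞}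
    (hψ : α.IsContactomorphism ψ) : α.IsContactomorphism ψ⁻¹ := by
  intro y
  obtain ⟨x, rfl⟩ : ∃ x, ψ x = y := ⟨ψ.symm y, ψ.apply_symm_apply y⟩
  have aux : ∀ (z : N) (L : TangentSpace (𝓡 (2 * n + 1)) (ψ x) →L[ℝ] TangentSpace (𝓡 (2 * n + 1)) z),
      z = x →
      (∀ v, L (mfderiv (𝓡 (2 * n + 1)) (𝓡 (2 * n + 1)) ψ x v) = v) →
      (∀ v, mfderiv (𝓡 (2 * n + 1)) (𝓡 (2 * n + 1)) ψ x (L v) = v) →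
      (α.contactPlane (ψ x)).map L.toLinearMap = α.contactPlane z ∧
        ∀ v, 0 < α.form (ψ x) v → 0 < α.form z (L v) := by
    intro z L hz h1 h2
    subst hz
    obtain ⟨hk, hp⟩ := hψ z
    refine ⟨?_, fun v hv => ?_⟩
    · rw [← hk, ← Submodule.map_comp]
      have : L.toLinearMap ∘ₗ
          (mfderiv (𝓡 (2 * n + 1)) (𝓡 (2 * n + 1)) ψ z).toLinearMap = LinearMap.id :=
        LinearMap.ext h1
      rw [this, Submodule.map_id]
    · rcases lt_trichotomy (α.form z (L v)) 0 with h | h | h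
      · have := hp (-(L v)) (by rw [map_neg]; linarith)
        rw [map_neg, h2, map_neg] at this
        linarith
      · have hm : mfderiv (𝓡 (2 * n + 1)) (𝓡 (2 * n + 1)) ψ z (L v) ∈ α.contactPlane (ψ z) := by
          rw [← hk]; exact Submodule.mem_map_of_mem (p := α.contactPlane z) h
        rw [h2] at hm
        have hm' : α.form (ψ z) v = 0 := hm
        linarith
      · exact h
  have hψd : MDifferentiable (𝓡 (2 * n + 1)) (𝓡 (2 * n + 1)) ψ := ψ.mdifferentiable (by simp)
  have hψd' : MDifferentiable (𝓡 (2 * n + 1)) (𝓡 (2 * n + 1)) ψ.symm :=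
    ψ.symm.mdifferentiable (by simp)
  have hx : ψ.symm (ψ x) = x := ψ.symm_apply_apply x
  refine aux (ψ.symm (ψ x)) (mfderiv (𝓡 (2 * n + 1)) (𝓡 (2 * n + 1)) ψ.symm (ψ x)) hx ?_ ?_
  · intro v
    have h := mfderiv_comp_apply x (hψd' (ψ x)) (hψd x) v
    have e : (⇑ψ.symm ∘ ⇑ψ) = id := funext ψ.symm_apply_apply
    rw [e, mfderiv_id] at h
    exact h.symm
  · intro v
    have h := mfderiv_comp_apply_of_eq (x := ψ x) (hψd x) (hψd' (ψ x)) hx v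
    have e : (⇑ψ ∘ ⇑ψ.symm) = id := funext ψ.apply_symm_apply
    rw [e, mfderiv_id] at h
    exact h.symm

/-- `G = Cont₀(N, ξ)`: the group of contactomorphisms isotopic to the identity through
contactomorphisms. -/
def contactGroup (α : ContactForm n N) :
    Subgroup (Diffeomorph (𝓡 (2 * n + 1)) (𝓡 (2 * n + 1)) N N ∞) where
  carrier := {ψ | ∃ Ψ : α.ContactIsotopy, Ψ.toFun 1 = ψ}
  one_mem' := ⟨⟨fun _ => 1, rfl, fun _ _ => α.isContactomorphism_one,
    contMDiff_snd.contMDiffOn⟩, rfl⟩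
  mul_mem' := by
    rintro _ _ ⟨Φ, rfl⟩ ⟨Ψ, rfl⟩
    refine ⟨⟨fun t => Φ.toFun t * Ψ.toFun t, by rw [Φ.zero, Ψ.zero, mul_one],
      fun t ht => (Φ.contact t ht).mul (Ψ.contact t ht), ?_⟩, rfl⟩
    exact Φ.smooth.comp (contMDiff_fst.contMDiffOn.prodMk Ψ.smooth)
      fun p hp => ⟨hp.1, mem_univ _⟩
  inv_mem' := by
    rintro _ ⟨Ψ, rfl⟩
    refine ⟨⟨fun t => Ψ.toFun (1 - t) * (Ψ.toFun 1)⁻¹, by simp, fun t ht =>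
      (Ψ.contact _ ⟨by linarith [ht.2], by linarith [ht.1]⟩).mul
        (Ψ.contact 1 (by simp)).inv, ?_⟩, by simp [Ψ.zero]⟩
    have h1 : ContMDiff (𝓘(ℝ).prod (𝓡 (2 * n + 1))) 𝓘(ℝ) ∞ (fun p : ℝ × N => 1 - p.1) :=
      ((contDiff_const (c := (1 : ℝ))).sub contDiff_id).contMDiff.comp contMDiff_fst
    have h2 : ContMDiff (𝓘(ℝ).prod (𝓡 (2 * n + 1))) (𝓡 (2 * n + 1)) ∞
        (fun p : ℝ × N => (Ψ.toFun 1).symm p.2) :=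
      (Ψ.toFun 1).symm.contMDiff.comp contMDiff_snd
    exact Ψ.smooth.comp (h1.prodMk h2).contMDiffOn
      fun p hp => ⟨⟨by linarith [hp.1.2], by linarith [hp.1.1]⟩, mem_univ _⟩

/-- The Reeb one-parameter subgroup `ℛ = {φ_R^t | t ∈ ℝ}` as a subset of `G`: `φ` is the
time-`t` map of the flow of the Reeb field when every `x` is carried to `φ x` in time `t` by an
integral curve of `R`. -/
def reebGroup (α : ContactForm n N) : Set α.contactGroup :=
  {φ | ∃ t : ℝ, ∀ x : N, ∃ γ : ℝ → N,
    IsMIntegralCurve (I := 𝓡 (2 * n + 1)) γ α.reebField ∧ γ 0 = x ∧ γ t = φ.1 x}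

/-! ### Energies -/

/-- The time derivative `d/dt ψ_t(x)` of an isotopy, a tangent vector at `ψ_t(x)`. -/
def ContactIsotopy.velocity {α : ContactForm n N} (Ψ : α.ContactIsotopy) (t : ℝ) (x : N) :
    TangentSpace (𝓡 (2 * n + 1)) (Ψ.toFun t x) :=
  mfderivWithin 𝓘(ℝ) (𝓡 (2 * n + 1)) (fun s : ℝ => Ψ.toFun s x) (Icc (0 : ℝ) 1) t (1 : ℝ)

/-- The contact Hamiltonian `H_t = α(Y_t)`, `Y_t = (d/dt ψ_t) ∘ ψ_t⁻¹`, of an isotopy. Here the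
base point `ψ_t(ψ_t⁻¹(y))` of `Y_t(y)` is `y`. -/
def ContactIsotopy.hamiltonian {α : ContactForm n N} (Ψ : α.ContactIsotopy) (t : ℝ) (y : N) : ℝ :=
  α.form (Ψ.toFun t ((Ψ.toFun t).symm y)) (Ψ.velocity t ((Ψ.toFun t).symm y))

/-- The Hofer energy `|ψ|_α`: the infimum of `∫₀¹ max_N |H_t| dt` over isotopies with
`ψ_1 = ψ`. -/
def hoferEnergy (α : ContactForm n N) (ψ : α.contactGroup) : ℝ :=
  ⨅ Ψ : {Ψ : α.ContactIsotopy // Ψ.toFun 1 = ψ.1},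
    ∫ t in (0 : ℝ)..1, ⨆ y : N, |Ψ.1.hamiltonian t y|

/-- The oscillation energy `|ψ|^osc_α`: the infimum of `∫₀¹ (max_N H_t - min_N H_t) dt` over
isotopies with `ψ_1 = ψ`. -/
def oscEnergy (α : ContactForm n N) (ψ : α.contactGroup) : ℝ :=
  ⨅ Ψ : {Ψ : α.ContactIsotopy // Ψ.toFun 1 = ψ.1},
    ∫ t in (0 : ℝ)..1, ((⨆ y : N, Ψ.1.hamiltonian t y) - ⨅ y : N, Ψ.1.hamiltonian t y)

/-- The contact Hofer metric `d_α(φ, ψ) = |ψ φ⁻¹|_α`. -/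
def hoferDist (α : ContactForm n N) (φ ψ : α.contactGroup) : ℝ :=
  α.hoferEnergy (ψ * φ⁻¹)

/-- The topology on `G` defined by the metric `d_α`: a set is open when it contains a `d_α`-ball
around each of its points. -/
@[reducible]
def hoferTopology (α : ContactForm n N) : TopologicalSpace α.contactGroup where
  IsOpen U := ∀ φ ∈ U, ∃ ε > 0, ∀ χ, α.hoferDist φ χ < ε → χ ∈ U
  isOpen_univ := fun _ _ => ⟨1, one_pos, fun _ _ => mem_univ _⟩
  isOpen_inter := fun U V hU hV φ hφ => by
    obtain ⟨a, ha, hUa⟩ := hU φ hφ.1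
    obtain ⟨b, hb, hVb⟩ := hV φ hφ.2
    exact ⟨min a b, lt_min ha hb, fun χ h =>
      ⟨hUa χ (h.trans_le (min_le_left _ _)), hVb χ (h.trans_le (min_le_right _ _))⟩⟩
  isOpen_sUnion := fun S hS φ ⟨U, hU, hφ⟩ => by
    obtain ⟨a, ha, h⟩ := hS U hU φ hφ
    exact ⟨a, ha, fun χ hχ => ⟨U, hU, h χ hχ⟩⟩

end ContactForm

end

/-! The Reeb flow preserves `α` and moves points with `α`-velocity 1. Hence composing a path of
contactomorphisms on the left with the Reeb flow at time `C(s)` only adds the function `C'(s)` of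
time to its contact Hamiltonian. Adding a function of time does not change the oscillation, and a
suitable one makes the Hamiltonian as small in absolute value as its oscillation.

Suppose an isotopy `Ψ` from the identity to `ψ` has small oscillation energy. Its Hamiltonian along
the orbit of one point `x₀` is a continuous function of time, close to a polynomial `p` with
primitive `P`, `P(0) = 0`. The path `s ↦ φ_R^{P(1)-P(1-s)} Ψ_{1-s} ψ⁻¹` goes from the identity to
`φ_R^{P(1)} ψ⁻¹`, and its Hamiltonian is bounded by the oscillation plus the approximation error. So
`φ_R^{P(1)}` is `d_α`-close to `ψ`. Conversely, let `X` be a path of small energy from the identity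
to `φ_R^T ψ⁻¹`. Then `s ↦ φ_R^{Ts-T} X_{1-s} ψ` goes from the identity to `ψ`, and its Hamiltonian
is `T` minus a small function, so it has small oscillation. Both paths are instances of `reebTwist`,
with Hamiltonian given by `alphaVelocity_reebTwist`. That closure points are approximated within
balls rests on the triangle inequality `hoferEnergy_mul_le`.

Most of the work supplies the Reeb flow. The Reeb field is smooth because it solves the invertible
linear system `(da + a ⊗ a) R = a` (`contDiffAt_reeb`). Its flow exists and is smooth by the inverse
function theorem in a space of curves together with compactness (`exists_contMDiff_flow`). It
preserves `α` because `dα(R, ·) = 0` and `α(R)` is constant (`hasDerivAt_pullback_eq_zero`,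
`onTangent_reebFlow`). -/

noncomputable section

/-! ### Smooth dependence of solutions of ordinary differential equations -/

/-! ### Superposition operators on spaces of continuous maps -/

section Superposition

set_option synthInstance.maxHeartbeats 400000

universe u

variable {K : Type*} [TopologicalSpace K] [CompactSpace K]
  {E F : Type u} [NormedAddCommGroup E] [NormedSpace ℝ E] [NormedAddCommGroup F] [NormedSpace ℝ F]

instance continuousMapCLMNormedAddCommGroup : NormedAddCommGroup C(K, E →L[ℝ] F) :=
  ContinuousMap.instNormedAddCommGroup

instance continuousMapCLMNormedSpace : NormedSpace ℝ C(K, E →L[ℝ] F) :=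
  ContinuousMap.normedSpace

/-- Pointwise application of a continuous family of operators to a continuous family of vectors,
as a bilinear map. -/
def ContinuousMap.pointwiseLM (K : Type*) [TopologicalSpace K]
    (E F : Type u) [NormedAddCommGroup E] [NormedSpace ℝ E]
    [NormedAddCommGroup F] [NormedSpace ℝ F] :
    C(K, E →L[ℝ] F) →ₗ[ℝ] C(K, E) →ₗ[ℝ] C(K, F) :=
  LinearMap.mk₂ ℝ (fun (A : C(K, E →L[ℝ] F)) (v : C(K, E)) =>
      (⟨fun s => A s (v s), A.continuous.clm_apply v.continuous⟩ : C(K, F)))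
    (fun _ _ _ => ContinuousMap.ext fun _ => by simp)
    (fun _ _ _ => ContinuousMap.ext fun _ => by simp)
    (fun _ _ _ => ContinuousMap.ext fun _ => by simp)
    (fun _ _ _ => ContinuousMap.ext fun _ => by simp)

/-- Pointwise application of a continuous family of operators to a continuous family of vectors,
as a bounded bilinear map. -/
def ContinuousMap.pointwiseCLM (K : Type*) [TopologicalSpace K] [CompactSpace K]
    (E F : Type u) [NormedAddCommGroup E] [NormedSpace ℝ E]
    [NormedAddCommGroup F] [NormedSpace ℝ F] :
    C(K, E →L[ℝ] F) →L[ℝ] C(K, E) →L[ℝ] C(K, F) :=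
  LinearMap.mkContinuous₂ (ContinuousMap.pointwiseLM K E F) 1 fun A v => by
    rw [one_mul, ContinuousMap.norm_le _ (by positivity)]
    intro s
    exact ((A s).le_opNorm _).trans
      (mul_le_mul (A.norm_coe_le_norm s) (v.norm_coe_le_norm s) (norm_nonneg _) (norm_nonneg _))

theorem ContinuousMap.pointwiseCLM_apply (A : C(K, E →L[ℝ] F)) (v : C(K, E)) (s : K) :
    ContinuousMap.pointwiseCLM K E F A v s = A s (v s) := rfl

/-- The superposition operator `u ↦ f ∘ u` of a `C¹` map is differentiable. -/
theorem ContinuousMap.hasFDerivAt_comp_left (f : C(E, F)) (f' : C(E, E →L[ℝ] F))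
    (hf : ∀ x, HasFDerivAt f (f' x) x) (u : C(K, E)) :
    HasFDerivAt (fun u : C(K, E) => f.comp u) (ContinuousMap.pointwiseCLM K E F (f'.comp u)) u := by
  rw [hasFDerivAt_iff_isLittleO_nhds_zero, Asymptotics.isLittleO_iff]
  intro ε hε
  -- Uniform continuity of `f'` near the compact range of `u` gives one `δ` for all points `s`, so
  -- the mean value inequality bounds the remainder in sup norm.
  have hunif := (isCompact_range u.continuous).uniformContinuousAt_of_continuousAt f'
    (fun x _ => f'.continuous.continuousAt) (Metric.dist_mem_uniformity hε)
  obtain ⟨δ, hδ, hδ'⟩ := Metric.mem_uniformity_dist.1 hunif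
  filter_upwards [Metric.ball_mem_nhds (0 : C(K, E)) hδ] with v hv
  rw [mem_ball_zero_iff] at hv
  rw [ContinuousMap.norm_le _ (by positivity)]
  intro s
  have hvs : ‖v s‖ ≤ ‖v‖ := v.norm_coe_le_norm s
  have hmv := (convex_ball (u s) δ).norm_image_sub_le_of_norm_hasFDerivWithin_le'
    (f := f) (f' := f') (φ := f' (u s)) (C := ε) (x := u s) (y := u s + v s)
    (fun x _ => (hf x).hasFDerivWithinAt)
    (fun x hx => by
      have := hδ' (a := u s) (b := x) (by rw [dist_comm]; exact hx) (mem_range_self s)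
      rw [← dist_eq_norm, dist_comm]; exact this.le)
    (Metric.mem_ball_self hδ) (by simpa using hvs.trans_lt hv)
  calc _ = ‖f (u s + v s) - f (u s) - f' (u s) (u s + v s - u s)‖ := by
        simp [ContinuousMap.pointwiseCLM_apply]
    _ ≤ ε * ‖u s + v s - u s‖ := hmv
    _ ≤ ε * ‖v‖ := by
        rw [add_sub_cancel_left]; gcongr

/-- The superposition operator `u ↦ f ∘ u` of a smooth map is smooth. -/
theorem ContinuousMap.contDiff_comp_left_nat (k : ℕ) :
    ∀ {F : Type u} [NormedAddCommGroup F] [NormedSpace ℝ F] (f : C(E, F)), ContDiff ℝ k f →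
      ContDiff ℝ k (fun u : C(K, E) => f.comp u) := by
  -- The derivative at `u` is superposition with `f'` followed by a bounded linear map. Since `f'`
  -- takes values in `E →L[ℝ] F`, the induction must run over all targets `F`, in one universe.
  induction k with
  | zero =>
    intro F _ _ f _
    exact contDiff_zero.2 f.continuous_postcomp
  | succ k ih =>
    intro F _ _ f hf
    push_cast at hf ⊢
    obtain ⟨-, -, hf'⟩ := contDiff_succ_iff_fderiv.1 hf
    let f' : C(E, E →L[ℝ] F) := ⟨fderiv ℝ f, hf'.continuous⟩
    refine contDiff_succ_iff_hasFDerivAt.2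
      ⟨fun u => ContinuousMap.pointwiseCLM K E F (f'.comp u), ?_, fun u => ?_⟩
    · exact (ContinuousMap.pointwiseCLM K E F).contDiff.comp (ih f' hf')
    · exact ContinuousMap.hasFDerivAt_comp_left f f'
        (fun x => (hf.differentiable (by simp) x).hasFDerivAt) u

theorem ContinuousMap.contDiff_comp_left (f : C(E, F)) (hf : ContDiff ℝ ∞ f) :
    ContDiff ℝ ∞ (fun u : C(K, E) => f.comp u) :=
  contDiff_infty.2 fun k => ContinuousMap.contDiff_comp_left_nat k f (contDiff_infty.1 hf k)

theorem ContinuousMap.contDiff_eval (x : K) :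
    ContDiff ℝ ∞ (fun u : C(K, E) => u x) :=
  (ContinuousMap.evalCLM ℝ x : C(K, E) →L[ℝ] E).contDiff

end Superposition

/-! ### Solutions over a fixed interval, by the inverse function theorem -/

section LocalFlow

universe u

variable {E : Type u} [NormedAddCommGroup E] [NormedSpace ℝ E] [CompleteSpace E]

theorem neg_two_le_two : (-2 : ℝ) ≤ 2 := by norm_num

/-- The integral `u ↦ (s ↦ ∫₀ˢ u)` as an operator on curves over `[-2, 2]`. -/
def primitiveCLM (E : Type u) [NormedAddCommGroup E] [NormedSpace ℝ E] [CompleteSpace E] :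
    C(Icc (-2 : ℝ) 2, E) →L[ℝ] C(Icc (-2 : ℝ) 2, E) :=
  LinearMap.mkContinuous
    { toFun := fun u => ⟨fun s => ∫ σ in (0 : ℝ)..s, u (projIcc (-2) 2 neg_two_le_two σ),
        (intervalIntegral.continuous_primitive
          (fun a b => (u.continuous.comp
            (continuous_projIcc (h := neg_two_le_two))).intervalIntegrable a b) 0).comp
          continuous_subtype_val⟩
      map_add' := fun u v => by
        ext s
        exact intervalIntegral.integral_add
          ((u.continuous.comp continuous_projIcc).intervalIntegrable _ _)
          ((v.continuous.comp continuous_projIcc).intervalIntegrable _ _)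
      map_smul' := fun c u => by
        ext s
        exact intervalIntegral.integral_smul c _ } 2
    (fun u => by
      rw [ContinuousMap.norm_le _ (by positivity)]
      intro s
      have h := intervalIntegral.norm_integral_le_of_norm_le_const (a := 0) (b := (s : ℝ))
        (f := fun σ => u (projIcc (-2) 2 neg_two_le_two σ)) (C := ‖u‖)
        (fun σ _ => u.norm_coe_le_norm _)
      refine h.trans ?_
      rw [mul_comm, sub_zero]
      gcongr
      exact abs_le.2 s.2)

/-- The shear `(τ, η, v) ↦ (τ, η, v + A (τ, η))` as a continuous linear equivalence. -/
def shearEquiv {V : Type*} [NormedAddCommGroup V] [NormedSpace ℝ V] (A : ℝ × E →L[ℝ] V) :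
    ((ℝ × E) × V) ≃L[ℝ] ((ℝ × E) × V) :=
  ContinuousLinearEquiv.equivOfInverse
    ((ContinuousLinearMap.fst ℝ (ℝ × E) V).prod
      (ContinuousLinearMap.snd ℝ (ℝ × E) V + A.comp (ContinuousLinearMap.fst ℝ (ℝ × E) V)))
    ((ContinuousLinearMap.fst ℝ (ℝ × E) V).prod
      (ContinuousLinearMap.snd ℝ (ℝ × E) V - A.comp (ContinuousLinearMap.fst ℝ (ℝ × E) V)))
    (fun x => by simp) (fun x => by simp)

/-- Solutions of `u' = t f(u)`, `u(0) = y`, over `[-2, 2]` exist and depend smoothly on `(t, y)`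
near `(0, y₀)`. -/
theorem exists_contDiffAt_integral_curves (f : E → E) (hf : ContDiff ℝ ∞ f) (y₀ : E) :
    ∃ g : ℝ × E → C(Icc (-2 : ℝ) 2, E), ContDiffAt ℝ ∞ g (0, y₀) ∧
      g (0, y₀) = ContinuousMap.const _ y₀ ∧
      ∀ᶠ p in 𝓝 ((0 : ℝ), y₀), ∀ s : Icc (-2 : ℝ) 2,
        g p s = p.2 + p.1 • ∫ σ in (0 : ℝ)..s, f (g p (projIcc (-2) 2 neg_two_le_two σ)) := by
  -- The factor `t` in `u' = t f(u)` replaces a short time interval by a small parameter. The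
  -- interval `[-2, 2]` has both 0 and 1 in its interior, so time-one values are available.
  let V := C(Icc (-2 : ℝ) 2, E)
  let fc : C(E, E) := ⟨f, hf.continuous⟩
  let c : E →L[ℝ] V := ContinuousLinearMap.const ℝ (Icc (-2 : ℝ) 2)
  -- The last component vanishes exactly on solutions of the integral equation. Carrying `(t, y)`
  -- along turns the implicit function problem into inverting `G`.
  let G : (ℝ × E) × V → (ℝ × E) × V := fun p =>
    (p.1, p.2 - c p.1.2 - p.1.1 • primitiveCLM E (fc.comp p.2))
  have hN : ContDiff ℝ ∞ (fun u : V => primitiveCLM E (fc.comp u)) :=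
    (primitiveCLM E).contDiff.comp (ContinuousMap.contDiff_comp_left fc hf)
  have hG : ContDiff ℝ ∞ G := by
    refine contDiff_fst.prodMk ((contDiff_snd.sub (c.contDiff.comp ?_)).sub
      ((contDiff_fst.comp contDiff_fst).smul (hN.comp contDiff_snd)))
    exact contDiff_snd.comp contDiff_fst
  let w : V := primitiveCLM E (fc.comp (c y₀))
  -- At `t = 0` the term `t ∫ f(u)` contributes no derivative in `u`, so `G` has derivative the
  -- identity in `u` plus the part `A` in `(t, y)`: an invertible shear.
  let A : ℝ × E →L[ℝ] V := -(c.comp (ContinuousLinearMap.snd ℝ ℝ E)) -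
    (ContinuousLinearMap.fst ℝ ℝ E).smulRight w
  let p₀ : (ℝ × E) × V := ((0, y₀), c y₀)
  have hG' : HasFDerivAt G (shearEquiv A : ((ℝ × E) × V) →L[ℝ] ((ℝ × E) × V)) p₀ := by
    have h1 : HasFDerivAt (fun p : (ℝ × E) × V => p.1) (ContinuousLinearMap.fst ℝ (ℝ × E) V) p₀ :=
      hasFDerivAt_fst
    have h2 : HasFDerivAt (fun p : (ℝ × E) × V => p.2) (ContinuousLinearMap.snd ℝ (ℝ × E) V) p₀ :=
      hasFDerivAt_snd
    have h3 := c.hasFDerivAt.comp p₀ ((hasFDerivAt_snd (𝕜 := ℝ) (p := p₀.1)).comp p₀ h1)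
    have h4 := (hasFDerivAt_fst (𝕜 := ℝ) (p := p₀.1)).comp p₀ h1
    have h5 := ((hN.differentiable (by simp) (c y₀)).hasFDerivAt).comp p₀ h2
    have h := h1.prodMk ((h2.sub h3).sub (h4.smul h5))
    refine h.congr_fderiv ?_
    ext p <;> simp [shearEquiv, A, p₀, w]
  have hGp : G p₀ = ((0, y₀), 0) := by simp [G, p₀]
  have hG1 : ContDiffAt ℝ ∞ G p₀ := hG.contDiffAt
  let L := hG1.localInverse hG' (by simp)
  have hL : ContDiffAt ℝ ∞ L ((0, y₀), 0) := hGp ▸ hG1.to_localInverse hG' (by simp)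
  have hL0 : L ((0, y₀), 0) = p₀ := hGp ▸ hG1.localInverse_apply_image hG' (by simp)
  have hLr : ∀ᶠ q in 𝓝 (((0 : ℝ), y₀), (0 : V)), G (L q) = q :=
    hGp ▸ (hG1.hasStrictFDerivAt' hG' (by simp)).eventually_right_inverse
  have hin : ContDiffAt ℝ ∞ (fun p : ℝ × E => (p, (0 : V))) (0, y₀) :=
    contDiffAt_id.prodMk contDiffAt_const
  refine ⟨fun p => (L (p, 0)).2, ?_, by simp only [hL0]; rfl, ?_⟩
  · exact contDiffAt_snd.comp _ (ContDiffAt.comp (0, y₀) (g := L) hL hin)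
  · filter_upwards [hin.continuousAt.eventually hLr] with p hp s
    have h1 : (L (p, 0)).1 = p := congrArg Prod.fst hp
    have h2 : (L (p, 0)).2 - c p.2 - p.1 • primitiveCLM E (fc.comp (L (p, 0)).2) = 0 := by
      have := congrArg Prod.snd hp
      simp only [G, h1] at this
      exact this
    rw [sub_sub, sub_eq_zero] at h2
    exact DFunLike.congr_fun h2 s

end LocalFlow

/-! ### Charts and tangent maps -/

section Charts

variable {m : ℕ} {M : Type*} [TopologicalSpace M] [ChartedSpace (EuclideanSpace ℝ (Fin m)) M]
  [IsManifold (𝓡 m) ∞ M]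

local notation "𝔼" => EuclideanSpace ℝ (Fin m)

/-- Over an open set the tangent map agrees with the one taken within the set. Applied to charts and
their inverses, it transports smooth vector fields and forms. -/
theorem contMDiffOn_tangentMap {E' H' M' : Type*} [NormedAddCommGroup E'] [NormedSpace ℝ E']
    [TopologicalSpace H'] {I' : ModelWithCorners ℝ E' H'} [TopologicalSpace M'] [ChartedSpace H' M']
    [IsManifold I' ∞ M']
    {E'' H'' M'' : Type*} [NormedAddCommGroup E''] [NormedSpace ℝ E'']
    [TopologicalSpace H''] {I'' : ModelWithCorners ℝ E'' H''} [TopologicalSpace M'']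
    [ChartedSpace H'' M''] [IsManifold I'' ∞ M'']
    {f : M' → M''} {U : Set M'} (hU : IsOpen U) (hf : ContMDiffOn I' I'' ∞ f U) :
    ContMDiffOn I'.tangent I''.tangent ∞ (tangentMap I' I'' f)
      (TotalSpace.proj ⁻¹' U : Set (TangentBundle I' M')) := by
  have : IsManifold I' 1 M' := .of_le (n := ∞) (by simp)
  have : IsManifold I'' 1 M'' := .of_le (n := ∞) (by simp)
  refine (hf.contMDiffOn_tangentMapWithin (m := ∞) (by simp) hU.uniqueMDiffOn).congr ?_
  intro p hp
  exact (tangentMapWithin_eq_tangentMap (hU.uniqueMDiffOn _ hp)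
    ((hf.contMDiffAt (hU.mem_nhds hp)).mdifferentiableAt (by simp))).symm

theorem contMDiffAt_extChartAt_symm {x : M} {y : 𝔼} (hy : y ∈ (extChartAt (𝓡 m) x).target) :
    ContMDiffAt 𝓘(ℝ, 𝔼) (𝓡 m) ∞ (extChartAt (𝓡 m) x).symm y :=
  (contMDiffOn_extChartAt_symm x).contMDiffAt ((isOpen_extChartAt_target x).mem_nhds hy)

theorem contMDiffAt_extChartAt_of_mem {x z : M} (hz : z ∈ (extChartAt (𝓡 m) x).source) :
    ContMDiffAt (𝓡 m) 𝓘(ℝ, 𝔼) ∞ (extChartAt (𝓡 m) x) z :=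
  contMDiffAt_extChartAt' (by rwa [extChartAt_source] at hz)

theorem mfderiv_extChartAt_symm_apply {x z : M} (hz : z ∈ (extChartAt (𝓡 m) x).source)
    (w : TangentSpace (𝓡 m) z) :
    (mfderiv 𝓘(ℝ, 𝔼) (𝓡 m) (extChartAt (𝓡 m) x).symm (extChartAt (𝓡 m) x z) : 𝔼 →L[ℝ] 𝔼)
      (mfderiv (𝓡 m) 𝓘(ℝ, 𝔼) (extChartAt (𝓡 m) x) z w) = w := by
  have : IsManifold (𝓡 m) 1 M := .of_le (n := ∞) (by simp)
  have h := mfderivWithin_extChartAt_symm_comp_mfderiv_extChartAt' (I := 𝓡 m) hz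
  simp only [modelWithCornersSelf_coe, range_id, mfderivWithin_univ] at h
  exact DFunLike.congr_fun h w

theorem mfderiv_extChartAt_apply {x : M} {y : 𝔼} (hy : y ∈ (extChartAt (𝓡 m) x).target) (w : 𝔼) :
    (mfderiv (𝓡 m) 𝓘(ℝ, 𝔼) (extChartAt (𝓡 m) x) ((extChartAt (𝓡 m) x).symm y) : 𝔼 →L[ℝ] 𝔼)
      (mfderiv 𝓘(ℝ, 𝔼) (𝓡 m) (extChartAt (𝓡 m) x).symm y w) = w := by
  have : IsManifold (𝓡 m) 1 M := .of_le (n := ∞) (by simp)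
  have h := mfderiv_extChartAt_comp_mfderivWithin_extChartAt_symm (I := 𝓡 m) hy
  simp only [modelWithCornersSelf_coe, range_id, mfderivWithin_univ] at h
  exact DFunLike.congr_fun h w

/-- A vector field read in the chart at `x`. -/
def chartField (v : ∀ x : M, TangentSpace (𝓡 m) x) (x : M) (y : 𝔼) : 𝔼 :=
  mfderiv (𝓡 m) 𝓘(ℝ, 𝔼) (extChartAt (𝓡 m) x) ((extChartAt (𝓡 m) x).symm y)
    (v ((extChartAt (𝓡 m) x).symm y))

theorem mfderiv_symm_chartField (v : ∀ x : M, TangentSpace (𝓡 m) x) {x : M} {y : 𝔼}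
    (hy : y ∈ (extChartAt (𝓡 m) x).target) :
    (mfderiv 𝓘(ℝ, 𝔼) (𝓡 m) (extChartAt (𝓡 m) x).symm y : 𝔼 →L[ℝ] 𝔼) (chartField v x y) =
      v ((extChartAt (𝓡 m) x).symm y) := by
  have h := mfderiv_extChartAt_symm_apply ((extChartAt (𝓡 m) x).map_target hy)
    (v ((extChartAt (𝓡 m) x).symm y))
  rwa [(extChartAt (𝓡 m) x).right_inv hy] at h

theorem hasMFDerivAt_extChartAt_symm_comp {x : M} {u : ℝ → 𝔼} {s : ℝ} {w : 𝔼}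
    (hs : u s ∈ (extChartAt (𝓡 m) x).target) (hu : HasDerivAt u w s) :
    HasMFDerivAt 𝓘(ℝ) (𝓡 m) (fun s => (extChartAt (𝓡 m) x).symm (u s)) s
      ((1 : ℝ →L[ℝ] ℝ).smulRight
        ((mfderiv 𝓘(ℝ, 𝔼) (𝓡 m) (extChartAt (𝓡 m) x).symm (u s) : 𝔼 →L[ℝ] 𝔼) w)) := by
  have h := ((contMDiffAt_extChartAt_symm hs).mdifferentiableAt
    (by simp)).hasMFDerivAt.comp s hu.hasFDerivAt.hasMFDerivAt
  refine h.congr_mfderiv (ContinuousLinearMap.ext_ring ?_)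
  change (mfderiv 𝓘(ℝ, 𝔼) (𝓡 m) (extChartAt (𝓡 m) x).symm (u s) : 𝔼 →L[ℝ] 𝔼) ((1 : ℝ) • w) =
    (1 : ℝ) • (mfderiv 𝓘(ℝ, 𝔼) (𝓡 m) (extChartAt (𝓡 m) x).symm (u s) : 𝔼 →L[ℝ] 𝔼) w
  rw [one_smul, one_smul]

theorem contDiffOn_chartField {v : ∀ x : M, TangentSpace (𝓡 m) x}
    (hv : ContMDiff (𝓡 m) (𝓡 m).tangent ∞ (fun x => (⟨x, v x⟩ : TangentBundle (𝓡 m) M))) (x : M) :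
    ContDiffOn ℝ ∞ (chartField v x) (extChartAt (𝓡 m) x).target := by
  refine contMDiffOn_iff_contDiffOn.1 ?_
  have h1 := contMDiffOn_tangentMap (I' := 𝓡 m) (I'' := 𝓘(ℝ, 𝔼))
    (isOpen_extChartAt_source (I := 𝓡 m) x)
    (by rw [extChartAt_source]; exact contMDiffOn_extChartAt (I := 𝓡 m) (n := ∞) (x := x))
  have h2 := h1.comp (hv.comp_contMDiffOn (contMDiffOn_extChartAt_symm (I := 𝓡 m) (n := ∞) x))
    (fun y hy => (extChartAt (𝓡 m) x).map_target hy)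
  exact (contMDiff_snd_tangentBundle_modelSpace 𝔼 𝓘(ℝ, 𝔼)).comp_contMDiffOn h2

end Charts

/-! ### The flow of a vector field on a compact manifold -/

section Flow

variable {m : ℕ} {M : Type*} [TopologicalSpace M] [ChartedSpace (EuclideanSpace ℝ (Fin m)) M]
  [IsManifold (𝓡 m) ∞ M]

local notation "𝔼" => EuclideanSpace ℝ (Fin m)

/-- A map which is smooth on a neighbourhood of a point agrees near the point with a map which is
smooth everywhere. -/
theorem exists_contDiff_eventuallyEq {f : 𝔼 → 𝔼} {U : Set 𝔼} (hU : IsOpen U)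
    (hf : ContDiffOn ℝ ∞ f U) {y₀ : 𝔼} (hy₀ : y₀ ∈ U) :
    ∃ g : 𝔼 → 𝔼, ContDiff ℝ ∞ g ∧ g =ᶠ[𝓝 y₀] f := by
  obtain ⟨r, hr, hrU⟩ := Metric.isOpen_iff.1 hU y₀ hy₀
  let χ : ContDiffBump y₀ := ⟨r / 4, r / 2, by positivity, by linarith⟩
  refine ⟨fun y => χ y • f y, ?_, ?_⟩
  · rw [← contMDiff_iff_contDiff]
    refine contMDiff_of_tsupport fun y hy => ContDiffAt.contMDiffAt ?_
    have hyU : y ∈ U := by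
      have := tsupport_smul_subset_left (fun y => χ y) f hy
      rw [χ.tsupport_eq] at this
      exact hrU (Metric.closedBall_subset_ball (by simp only [χ]; linarith) this)
    exact χ.contDiff.contDiffAt.smul (hf.contDiffAt (hU.mem_nhds hyU))
  · filter_upwards [χ.eventuallyEq_one] with y hy
    simp [hy]

/-- Integral curves of `t • v` through `x` over a fixed interval exist, and their time one values
depend smoothly on `(t, x)` near `(0, x₀)`. -/
theorem exists_local_flow {v : ∀ x : M, TangentSpace (𝓡 m) x}
    (hv : ContMDiff (𝓡 m) (𝓡 m).tangent ∞ (fun x => (⟨x, v x⟩ : TangentBundle (𝓡 m) M))) (x₀ : M) :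
    ∃ G : ℝ × M → M, ContMDiffAt (𝓘(ℝ).prod (𝓡 m)) (𝓡 m) ∞ G (0, x₀) ∧
      ∀ᶠ p in 𝓝 ((0 : ℝ), x₀), ∃ γ : ℝ → M, γ 0 = p.2 ∧ γ 1 = G p ∧
        IsMIntegralCurveOn (I := 𝓡 m) γ (p.1 • v) (Ioo (-2) 2) := by
  set φ := extChartAt (𝓡 m) x₀ with hφ
  set y₀ := φ x₀ with hy₀
  have hy₀t : y₀ ∈ φ.target := mem_extChartAt_target x₀
  -- The superposition operator requires a field that is smooth on the whole model space, so the
  -- chart field is cut off away from `y₀`.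
  obtain ⟨f, hf, hfeq⟩ := exists_contDiff_eventuallyEq (isOpen_extChartAt_target x₀)
    (contDiffOn_chartField hv x₀) hy₀t
  obtain ⟨r, hr, hrS⟩ := Metric.mem_nhds_iff.1
    (Filter.inter_mem ((isOpen_extChartAt_target x₀).mem_nhds hy₀t) hfeq)
  obtain ⟨g, hg, hg0, hgint⟩ := exists_contDiffAt_integral_curves f hf y₀
  -- Closeness in sup norm to the constant curve keeps the entire curve in the ball where `f` is
  -- still the chart field.
  have hclose : ∀ᶠ p in 𝓝 ((0 : ℝ), y₀), g p ∈ Metric.ball (g (0, y₀)) r :=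
    hg.continuousAt.eventually (Metric.ball_mem_nhds _ hr)
  have hφc : ContMDiffAt (𝓘(ℝ).prod (𝓡 m)) 𝓘(ℝ, ℝ × 𝔼) ∞
      (fun p : ℝ × M => (p.1, φ p.2)) (0, x₀) :=
    contMDiffAt_fst.prodMk_space (ContMDiffAt.comp (I' := 𝓡 m) (g := φ) (0, x₀)
      contMDiffAt_extChartAt contMDiffAt_snd)
  let one : Icc (-2 : ℝ) 2 := ⟨1, by norm_num⟩
  have hev : ContDiffAt ℝ ∞ (fun p => g p one) (0, y₀) :=
    (ContinuousMap.contDiff_eval one).contDiffAt.comp _ hg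
  refine ⟨fun p => φ.symm (g (p.1, φ p.2) one), ?_, ?_⟩
  · have h1 : ContMDiffAt (𝓘(ℝ).prod (𝓡 m)) 𝓘(ℝ, 𝔼) ∞
        (fun p : ℝ × M => g (p.1, φ p.2) one) (0, x₀) :=
      ContMDiffAt.comp (I' := 𝓘(ℝ, ℝ × 𝔼)) (0, x₀) hev.contMDiffAt hφc
    refine ContMDiffAt.comp (I' := 𝓘(ℝ, 𝔼)) (0, x₀) ?_ h1
    apply contMDiffAt_extChartAt_symm
    simp only [← hy₀, hg0]
    exact hy₀t
  · have hsrc : ∀ᶠ p in 𝓝 ((0 : ℝ), x₀), p.2 ∈ φ.source :=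
      continuousAt_snd.eventually (extChartAt_source_mem_nhds x₀)
    filter_upwards [hφc.continuousAt.eventually (hgint.and hclose), hsrc] with p ⟨hp, hpr⟩ hps
    set q : ℝ × 𝔼 := (p.1, φ p.2)
    let u : ℝ → 𝔼 := fun s => g q (projIcc (-2) 2 neg_two_le_two s)
    have hucont : Continuous u := (g q).continuous.comp continuous_projIcc
    have hu : ∀ s ∈ Icc (-2 : ℝ) 2, u s = q.2 + q.1 • ∫ σ in (0 : ℝ)..s, f (u σ) := by
      intro s hs
      simp only [u, projIcc_of_mem _ hs]
      exact hp ⟨s, hs⟩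
    have huS : ∀ s, u s ∈ φ.target ∧ f (u s) = chartField v x₀ (u s) := by
      intro s
      apply hrS
      rw [Metric.mem_ball] at hpr ⊢
      refine lt_of_le_of_lt ?_ hpr
      rw [hg0]
      exact ContinuousMap.dist_apply_le_dist (f := g q) (g := ContinuousMap.const _ y₀) _
    refine ⟨fun s => φ.symm (u s), ?_, ?_, ?_⟩
    · simp only [hu 0 (by norm_num), intervalIntegral.integral_same, smul_zero, add_zero]
      exact φ.left_inv hps
    · have h1 : projIcc (-2) 2 neg_two_le_two 1 = one := projIcc_of_mem _ one.2
      simp only [u, h1, q]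
    · intro s hs
      apply HasMFDerivAt.hasMFDerivWithinAt
      have hd : HasDerivAt u (q.1 • f (u s)) s := by
        have h1 : HasDerivAt (fun s => q.2 + q.1 • ∫ σ in (0 : ℝ)..s, f (u σ)) (q.1 • f (u s)) s :=
          ((hf.continuous.comp hucont).integral_hasStrictDerivAt 0 s).hasDerivAt.const_smul q.1
            |>.const_add q.2
        refine h1.congr_of_eventuallyEq ?_
        filter_upwards [isOpen_Ioo.mem_nhds hs] with s' hs'
        exact hu s' (Ioo_subset_Icc_self hs')
      have h3 := mfderiv_symm_chartField v (huS s).1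
      rw [← (huS s).2] at h3
      refine (hasMFDerivAt_extChartAt_symm_comp (huS s).1 hd).congr_mfderiv ?_
      have h4 := ((mfderiv 𝓘(ℝ, 𝔼) (𝓡 m) φ.symm (u s) : 𝔼 →L[ℝ] 𝔼).map_smul q.1 (f (u s))).trans
        (congrArg (fun w : 𝔼 => q.1 • w) h3)
      exact congrArg (fun w : 𝔼 => (1 : ℝ →L[ℝ] ℝ).smulRight w) h4

variable [CompactSpace M] [T2Space M]

/-- Vector fields on compact manifolds are complete. -/
theorem exists_isMIntegralCurve {v : ∀ x : M, TangentSpace (𝓡 m) x}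
    (hv : ContMDiff (𝓡 m) (𝓡 m).tangent ∞ (fun x => (⟨x, v x⟩ : TangentBundle (𝓡 m) M))) (x : M) :
    ∃ γ : ℝ → M, γ 0 = x ∧ IsMIntegralCurve (I := 𝓡 m) γ v := by
  have : IsManifold (𝓡 m) 1 M := .of_le (n := ∞) (by simp)
  -- Compactness makes the admissible parameter `t` uniform in the starting point.
  have h := isCompact_univ.eventually_forall_of_forall_eventually (x₀ := (0 : ℝ))
    (P := fun t x => ∃ γ : ℝ → M, γ 0 = x ∧ IsMIntegralCurveOn (I := 𝓡 m) γ (t • v) (Ioo (-2) 2))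
    (fun x₀ _ => by
      obtain ⟨G, -, hG⟩ := exists_local_flow hv x₀
      exact hG.mono fun p ⟨γ, h1, _, h2⟩ => ⟨γ, h1, h2⟩)
  obtain ⟨ε, hε, hε'⟩ := Metric.eventually_nhds_iff.1 h
  have ht : ε / 2 ≠ 0 := by positivity
  refine exists_isMIntegralCurve_of_isMIntegralCurveOn (hv.of_le (by simp)) (ε := ε / 2)
    (by positivity) (fun x => ?_) x
  obtain ⟨γ, h0, hγ⟩ := hε' (y := ε / 2) (by
    rw [Real.dist_eq, sub_zero, abs_of_pos (by positivity)]; linarith) x (mem_univ _)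
  -- Slowing down by `ε / 2` turns a curve of `(ε / 2) • v` on `(-2, 2)` into a curve of `v` on
  -- `(-ε, ε)`, of which only `(-ε / 2, ε / 2)` is needed.
  refine ⟨γ ∘ (· * (ε / 2)⁻¹), by simpa using h0, ?_⟩
  have h1 := hγ.comp_mul (ε / 2)⁻¹
  rw [smul_smul, inv_mul_cancel₀ ht, one_smul] at h1
  refine h1.mono fun s hs => ?_
  have h2 : |s * (ε / 2)⁻¹| < 1 := by
    rw [← div_eq_mul_inv, abs_div, abs_of_pos (show 0 < ε / 2 by positivity),
      div_lt_one (by positivity)]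
    exact abs_lt.2 hs
  exact ⟨by linarith [(abs_lt.1 h2).1], by linarith [(abs_lt.1 h2).2]⟩

/-- A smooth vector field on a compact manifold has a smooth global flow. -/
theorem exists_contMDiff_flow {v : ∀ x : M, TangentSpace (𝓡 m) x}
    (hv : ContMDiff (𝓡 m) (𝓡 m).tangent ∞ (fun x => (⟨x, v x⟩ : TangentBundle (𝓡 m) M))) :
    ∃ Φ : ℝ → M → M, (∀ x, Φ 0 x = x) ∧ (∀ s t x, Φ (s + t) x = Φ s (Φ t x)) ∧
      (∀ x, IsMIntegralCurve (I := 𝓡 m) (fun t => Φ t x) v) ∧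
      ContMDiff (𝓘(ℝ).prod (𝓡 m)) (𝓡 m) ∞ (fun p : ℝ × M => Φ p.1 p.2) := by
  have : IsManifold (𝓡 m) 1 M := .of_le (n := ∞) (by simp)
  choose Ψ hΨ0 hΨ using exists_isMIntegralCurve hv
  have hv1 := hv.of_le (show (1 : WithTop ℕ∞) ≤ ∞ by simp)
  have hadd : ∀ s t x, Ψ x (s + t) = Ψ (Ψ x t) s := by
    intro s t x
    have h := isMIntegralCurve_Ioo_eq_of_contMDiff_boundaryless (t₀ := 0) hv1
      ((hΨ x).comp_add t) (hΨ (Ψ x t)) (by simp [hΨ0])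
    exact congrFun h s
  refine ⟨fun t x => Ψ x t, hΨ0, hadd, hΨ, ?_⟩
  have hloc : ∀ x₀, ContMDiffAt (𝓘(ℝ).prod (𝓡 m)) (𝓡 m) ∞ (fun p : ℝ × M => Ψ p.2 p.1)
      (0, x₀) := by
    intro x₀
    obtain ⟨G, hG, hev⟩ := exists_local_flow hv x₀
    refine hG.congr_of_eventuallyEq (hev.mono fun p ⟨γ, h0, h1, hγ⟩ => ?_)
    have hsm : ContMDiff (𝓡 m) (𝓡 m).tangent 1
        (fun x => (⟨x, (p.1 • v) x⟩ : TangentBundle (𝓡 m) M)) := hv1.const_smul_section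
    -- By uniqueness, the time-one value of the field `t • v` is the time-`t` value of `v`.
    have h2 := isMIntegralCurveOn_Ioo_eqOn_of_contMDiff_boundaryless (t₀ := 0) (by norm_num) hsm
      (((hΨ p.2).comp_mul p.1).isMIntegralCurveOn _) hγ (by simp [hΨ0, h0])
    have h3 := h2 (show (1 : ℝ) ∈ Ioo (-2) 2 by norm_num)
    simpa [h1] using h3
  -- Smoothness at a point spreads to a neighbourhood only for a finite order `k`, and the resulting
  -- `ε` may depend on `k`.
  rw [contMDiff_infty]
  intro k
  have hunif := isCompact_univ.eventually_forall_of_forall_eventually (x₀ := (0 : ℝ))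
    (P := fun t x => ContMDiffAt (𝓘(ℝ).prod (𝓡 m)) (𝓡 m) (k : ℕ) (fun p : ℝ × M => Ψ p.2 p.1)
      (t, x))
    (fun x₀ _ => by
      have := IsManifold.of_le (I := 𝓡 m) (M := M)
        (show ((k : ℕ) : WithTop ℕ∞) ≤ ∞ from mod_cast le_top)
      exact (contMDiffAt_iff_contMDiffAt_nhds (by simp)).1 ((hloc x₀).of_le (mod_cast le_top)))
  obtain ⟨ε, hε, hε'⟩ := Metric.eventually_nhds_iff.1 hunif
  have hsmall : ∀ t : ℝ, |t| < ε → ContMDiff (𝓡 m) (𝓡 m) (k : ℕ) (fun x => Ψ x t) := by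
    intro t ht x
    exact ContMDiffAt.comp x (hε' (by simpa using ht) x (mem_univ _))
      (contMDiffAt_const.prodMk contMDiffAt_id)
  -- Any time `t` is reached by `j` steps of length `t / j`, each shorter than `ε`.
  have hmul : ∀ (j : ℕ) (t : ℝ), |t| < ε →
      ContMDiff (𝓡 m) (𝓡 m) (k : ℕ) (fun x => Ψ x (j * t)) := by
    intro j t ht
    induction j with
    | zero => simpa [hΨ0] using! contMDiff_id
    | succ j ih =>
      have h : (fun x => Ψ x ((j + 1 : ℕ) * t)) = (fun x => Ψ x t) ∘ (fun x => Ψ x (j * t)) := by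
        ext x
        rw [Function.comp_apply, ← hadd]
        congr 1; push_cast; ring
      rw [h]
      exact (hsmall t ht).comp ih
  have hall : ∀ t : ℝ, ContMDiff (𝓡 m) (𝓡 m) (k : ℕ) (fun x => Ψ x t) := by
    intro t
    obtain ⟨j, hj⟩ := exists_nat_gt (|t| / ε)
    have hj0 : (0 : ℝ) < j := lt_of_le_of_lt (by positivity) hj
    have h := hmul j (t / j) (by
      rw [abs_div, abs_of_pos hj0, div_lt_iff₀ hj0]
      rwa [div_lt_iff₀ hε, mul_comm] at hj)
    rwa [mul_div_cancel₀ _ hj0.ne'] at h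
  rintro ⟨t₀, x₀⟩
  -- The group law moves joint smoothness from time 0 to time `t₀`: the flow at `t` is the flow at
  -- `t - t₀` after the flow at `t₀`.
  have heq : (fun p : ℝ × M => Ψ p.2 p.1) =
      (fun p : ℝ × M => Ψ p.2 p.1) ∘ (fun p : ℝ × M => (p.1 - t₀, Ψ p.2 t₀)) := by
    ext p
    rw [Function.comp_apply, ← hadd, sub_add_cancel]
  rw [heq]
  refine ContMDiffAt.comp (I' := 𝓘(ℝ).prod (𝓡 m)) (t₀, x₀) (by
    simp only [sub_self]
    exact (hloc _).of_le (mod_cast le_top)) ?_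
  exact (contMDiffAt_fst.sub contMDiffAt_const).prodMk
    ((hall t₀).contMDiffAt.comp (t₀, x₀) contMDiffAt_snd)

end Flow

/-! ### Contact forms in charts -/

section TangentMap

variable {E H M : Type*} [NormedAddCommGroup E] [NormedSpace ℝ E]
  [TopologicalSpace H] {I : ModelWithCorners ℝ E H} [TopologicalSpace M] [ChartedSpace H M]
  {E' H' M' : Type*} [NormedAddCommGroup E'] [NormedSpace ℝ E']
  [TopologicalSpace H'] {I' : ModelWithCorners ℝ E' H'} [TopologicalSpace M'] [ChartedSpace H' M']

/-- The vectors are typed in the model space, so vectors over base points that are only provably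
equal can be compared without transport. -/
theorem tangentBundle_ext {x y : M'} {v w : E'} (h : x = y) (h' : v = w) :
    (⟨x, v⟩ : TangentBundle I' M') = ⟨y, w⟩ := by
  subst h h'; rfl

theorem tangentMap_congr {f g : M → M'} {x : M} (h : f =ᶠ[𝓝 x] g) (v : TangentSpace I x) :
    tangentMap I I' f ⟨x, v⟩ = tangentMap I I' g ⟨x, v⟩ := by
  have h2 : (mfderiv I I' f x : E →L[ℝ] E') = mfderiv I I' g x := h.mfderiv_eq
  exact tangentBundle_ext h.eq_of_nhds (DFunLike.congr_fun h2 v)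

end TangentMap

/-! ### Exterior derivatives and Reeb vectors on a vector space -/

section ExteriorDerivative

set_option synthInstance.maxHeartbeats 400000

variable {E : Type*} [NormedAddCommGroup E] [NormedSpace ℝ E]
  {F : Type*} [NormedAddCommGroup F] [NormedSpace ℝ F]

/-- The exterior derivative of a one-form on a vector space, as a bilinear form. -/
def oneFormCurl (a : E → E →L[ℝ] ℝ) (y u v : E) : ℝ :=
  fderiv ℝ a y u v - fderiv ℝ a y v u

theorem oneFormCurl_congr {a b : E → E →L[ℝ] ℝ} {y : E} (h : a =ᶠ[𝓝 y] b) (u v : E) :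
    oneFormCurl a y u v = oneFormCurl b y u v := by
  rw [oneFormCurl, oneFormCurl, h.fderiv_eq]

/-- Links the exterior derivative used for contact forms to the antisymmetrised derivative in which
the computations are carried out. -/
theorem extDeriv_ofSubsingleton {a : E → E →L[ℝ] ℝ} {y : E} (ha : DifferentiableAt ℝ a y)
    (u v : E) :
    extDeriv (fun y => ContinuousAlternatingMap.ofSubsingleton ℝ E ℝ (0 : Fin 1) (a y)) y ![u, v] =
      oneFormCurl a y u v := by
  have hd : DifferentiableAt ℝ
      (fun y => ContinuousAlternatingMap.ofSubsingleton ℝ E ℝ (0 : Fin 1) (a y)) y :=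
    (ContinuousAlternatingMap.ofSubsingletonLIE (𝕜 := ℝ) (E := E) (F := ℝ)
      (0 : Fin 1)).differentiable.differentiableAt.comp y ha
  rw [extDeriv_apply hd]
  have h : ∀ w : E, fderiv ℝ (fun y => a y w) y = (fderiv ℝ a y).flip w := by
    intro w
    ext u
    rw [fderiv_clm_apply ha (differentiableAt_const w)]
    simp
  simp [Fin.sum_univ_two, h, Fin.removeNth, sub_eq_add_neg, oneFormCurl]

/-- Differentiating `a(f(y)) ∘ Df(y)` produces the extra term `a(D²f(u, v))`, which is symmetric in
`u, v` and cancels on antisymmetrising. -/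
theorem oneFormCurl_pullback {a : F → F →L[ℝ] ℝ} {f : E → F} {y : E}
    (ha : DifferentiableAt ℝ a (f y)) (hf : ContDiffAt ℝ ∞ f y) (u v : E) :
    oneFormCurl (fun y => (a (f y)).comp (fderiv ℝ f y)) y u v =
      oneFormCurl a (f y) (fderiv ℝ f y u) (fderiv ℝ f y v) := by
  have hff : HasFDerivAt (fderiv ℝ f) (fderiv ℝ (fderiv ℝ f) y) y :=
    ((hf.fderiv_right (m := 1) (by norm_cast)).differentiableAt (by simp)).hasFDerivAt
  have hf1 : HasFDerivAt f (fderiv ℝ f y) y := (hf.differentiableAt (by simp)).hasFDerivAt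
  have h := (ha.hasFDerivAt.comp y hf1).clm_comp hff
  have hsymm : IsSymmSndFDerivAt ℝ f y := hf.isSymmSndFDerivAt (by
    rw [minSmoothness_of_isRCLikeNormedField]; exact WithTop.coe_le_coe.2 le_top)
  have he := h.fderiv
  have h2 : ∀ u v, fderiv ℝ (fun y => (a (f y)).comp (fderiv ℝ f y)) y u v =
      fderiv ℝ a (f y) (fderiv ℝ f y u) (fderiv ℝ f y v) +
        a (f y) (fderiv ℝ (fderiv ℝ f) y u v) := by
    intro u v
    refine (DFunLike.congr_fun (DFunLike.congr_fun he u) v).trans ?_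
    simp [add_comm]
  rw [oneFormCurl, oneFormCurl, h2, h2, hsymm u v]
  ring

/-- If `a(∂ₜ h) = 1` and `∂ₜ h` is in the kernel of `da`, then `h^* a` is constant in time
on vectors tangent to the second factor. -/
theorem hasDerivAt_pullback_eq_zero {a : F → F →L[ℝ] ℝ} {h : ℝ × E → F} {t₀ : ℝ} {y₀ : E}
    (ha : DifferentiableAt ℝ a (h (t₀, y₀))) (hh : ContDiffAt ℝ ∞ h (t₀, y₀))
    (hone : ∀ᶠ p in 𝓝 (t₀, y₀), a (h p) (fderiv ℝ h p (1, 0)) = 1)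
    (hker : ∀ w, oneFormCurl a (h (t₀, y₀)) (fderiv ℝ h (t₀, y₀) (1, 0)) w = 0) (w : E) :
    HasDerivAt (fun t => a (h (t, y₀)) (fderiv ℝ h (t, y₀) (0, w))) 0 t₀ := by
  obtain ⟨β, hβ_def⟩ : ∃ β : ℝ × E → ℝ × E →L[ℝ] ℝ, β = fun p => (a (h p)).comp (fderiv ℝ h p) :=
    ⟨_, rfl⟩
  have hβ : DifferentiableAt ℝ β (t₀, y₀) := by
    rw [hβ_def]
    exact (ha.comp (t₀, y₀) (hh.differentiableAt (by simp))).clm_comp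
      ((hh.fderiv_right (m := 1) (by norm_cast)).differentiableAt (by simp))
  -- With `β = h^* a`, the hypothesis `hker` gives `dβ(∂ₜ, w) = 0`. As `β(∂ₜ) = 1` near the point,
  -- the term `∂_w β(∂ₜ)` vanishes, leaving `∂ₜ β(w) = 0`.
  have h1 := oneFormCurl_pullback ha hh (1, 0) (0, w)
  rw [hker, ← hβ_def, oneFormCurl] at h1
  have h2 : fderiv ℝ β (t₀, y₀) (0, w) (1, 0) = 0 := by
    have h3 : (fun p => β p (1, 0)) =ᶠ[𝓝 (t₀, y₀)] fun _ => (1 : ℝ) :=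
      hone.mono fun p hp => by rw [hβ_def]; exact hp
    have h4 : HasFDerivAt (fun p => β p (1, 0)) _ (t₀, y₀) :=
      hβ.hasFDerivAt.clm_apply (hasFDerivAt_const ((1 : ℝ), (0 : E)) (t₀, y₀))
    have h5 := h4.unique ((hasFDerivAt_const (1 : ℝ) (t₀, y₀)).congr_of_eventuallyEq h3)
    simpa using DFunLike.congr_fun h5 (0, w)
  rw [h2, sub_zero] at h1
  have h4 : HasDerivAt (fun t : ℝ => (t, y₀)) ((1 : ℝ), (0 : E)) t₀ :=
    (hasDerivAt_id t₀).prodMk (hasDerivAt_const t₀ y₀)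
  have h5 : HasDerivAt (fun t => β (t, y₀)) (fderiv ℝ β (t₀, y₀) (1, 0)) t₀ :=
    hβ.hasFDerivAt.comp_hasDerivAt t₀ h4
  have h6 := h5.clm_apply (hasDerivAt_const t₀ ((0 : ℝ), w))
  rw [h1] at h6
  simpa [hβ_def] using h6

theorem oneFormCurl_self (a : E → E →L[ℝ] ℝ) (y u : E) : oneFormCurl a y u u = 0 := sub_self _

/-- The operator `da + a ⊗ a` of a one-form `a`. -/
def curlOperator (a : E → E →L[ℝ] ℝ) (y : E) : E →L[ℝ] E →L[ℝ] ℝ :=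
  fderiv ℝ a y - (fderiv ℝ a y).flip + (a y).smulRight (a y)

theorem curlOperator_apply (a : E → E →L[ℝ] ℝ) (y u v : E) :
    curlOperator a y u v = oneFormCurl a y u v + a y u * a y v := by
  simp [curlOperator, oneFormCurl]

theorem contDiff_flip : ContDiff ℝ ∞ (fun f : E →L[ℝ] E →L[ℝ] ℝ => f.flip) :=
  IsBoundedLinearMap.contDiff (𝕜 := ℝ) ⟨⟨fun _ _ => rfl, fun _ _ => rfl⟩, 1, one_pos,
    fun f => by rw [one_mul]; exact f.opNorm_flip.le⟩

theorem contDiffAt_curlOperator {a : E → E →L[ℝ] ℝ} {y : E} (ha : ContDiffAt ℝ ∞ a y) :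
    ContDiffAt ℝ ∞ (curlOperator a) y := by
  have h1 : ContDiffAt ℝ ∞ (fderiv ℝ a) y := ha.fderiv_right (by simp)
  have h2 : ContDiffAt ℝ ∞ (fun y => (fderiv ℝ a y).flip) y :=
    contDiff_flip.contDiffAt.comp y h1
  exact (h1.sub h2).add (ha.smulRight ha)

/-- If `w` is in the kernel, evaluating at `w` itself gives `a(w)² = 0` because `da(w, w) = 0`. Then
`da(w, ·) = 0`, and nondegeneracy gives `w = 0`; the dimensions agree. -/
theorem exists_equiv_curlOperator [FiniteDimensional ℝ E] {a : E → E →L[ℝ] ℝ} {y : E}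
    (hnd : ∀ w, a y w = 0 → (∀ v, oneFormCurl a y w v = 0) → w = 0) :
    ∃ e : E ≃L[ℝ] (E →L[ℝ] ℝ), (e : E →L[ℝ] E →L[ℝ] ℝ) = curlOperator a y := by
  have hinj : Function.Injective (curlOperator a y : E →ₗ[ℝ] E →L[ℝ] ℝ) := by
    rw [← LinearMap.ker_eq_bot, LinearMap.ker_eq_bot']
    intro w hw
    have h : ∀ v, oneFormCurl a y w v + a y w * a y v = 0 := by
      intro v
      rw [← curlOperator_apply]
      exact DFunLike.congr_fun hw v
    have h0 : a y w = 0 := by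
      have := h w
      rw [oneFormCurl_self, zero_add] at this
      exact mul_self_eq_zero.1 this
    refine hnd w h0 fun v => ?_
    have := h v
    rwa [h0, zero_mul, add_zero] at this
  have hrank : Module.finrank ℝ E = Module.finrank ℝ (E →L[ℝ] ℝ) := by
    rw [← (LinearMap.toContinuousLinearMap (𝕜 := ℝ) (E := E) (F' := ℝ)).finrank_eq]
    exact (Subspace.dual_finrank_eq (K := ℝ) (V := E)).symm
  refine ⟨(LinearEquiv.ofInjectiveOfFinrankEq (curlOperator a y : E →ₗ[ℝ] E →L[ℝ] ℝ) hinj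
    hrank).toContinuousLinearEquiv, ?_⟩
  ext u v
  rfl

/-- The solution `r` of `a(r) = 1`, `ι_r da = 0` is smooth. -/
theorem contDiffAt_reeb [FiniteDimensional ℝ E] {a : E → E →L[ℝ] ℝ} {r : E → E} {y : E}
    (ha : ContDiffAt ℝ ∞ a y)
    (hnd : ∀ᶠ z in 𝓝 y, ∀ w, a z w = 0 → (∀ v, oneFormCurl a z w v = 0) → w = 0)
    (hr : ∀ᶠ z in 𝓝 y, a z (r z) = 1 ∧ ∀ w, oneFormCurl a z (r z) w = 0) :
    ContDiffAt ℝ ∞ r y := by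
  have : CompleteSpace E := FiniteDimensional.complete ℝ E
  obtain ⟨e, he⟩ := exists_equiv_curlOperator hnd.self_of_nhds
  -- The two Reeb conditions combine into `(da + a ⊗ a) r = a`, so `r` is the smooth inverse
  -- operator applied to `a`.
  have h1 : ContDiffAt ℝ ∞ (fun z => ContinuousLinearMap.inverse (curlOperator a z)) y := by
    refine ContDiffAt.comp (g := ContinuousLinearMap.inverse) y ?_ (contDiffAt_curlOperator ha)
    rw [← he]
    exact contDiffAt_map_inverse e
  refine (h1.clm_apply ha).congr_of_eventuallyEq ?_
  filter_upwards [hnd, hr] with z hz hrz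
  obtain ⟨e', he'⟩ := exists_equiv_curlOperator hz
  have h2 : e' (r z) = a z := by
    ext v
    have h3 := DFunLike.congr_fun (DFunLike.congr_fun he' (r z)) v
    rw [curlOperator_apply, hrz.2, hrz.1, zero_add, one_mul] at h3
    exact h3
  rw [← he', ContinuousLinearMap.inverse_equiv, ← h2]
  exact (e'.symm_apply_apply _).symm

end ExteriorDerivative

namespace ContactForm

variable {n : ℕ} {N : Type*} [TopologicalSpace N]
  [ChartedSpace (EuclideanSpace ℝ (Fin (2 * n + 1))) N] [IsManifold (𝓡 (2 * n + 1)) ∞ N]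

local notation "𝔼" => EuclideanSpace ℝ (Fin (2 * n + 1))
local notation "𝓘N" => 𝓡 (2 * n + 1)

/-- A contact form as a function on the tangent bundle. -/
def onTangent (α : ContactForm n N) (W : TangentBundle (𝓡 (2 * n + 1)) N) : ℝ :=
  α.form W.1 W.2

/-- The section is pulled back to the tangent bundle and paired there with the tautological vector.
-/
theorem contMDiff_onTangent (α : ContactForm n N) :
    ContMDiff (𝓘N).tangent 𝓘(ℝ) ∞ α.onTangent := by
  have : IsManifold (𝓘N) 1 N := .of_le (n := ∞) (by simp)
  have h1 : ContMDiff (𝓘N).tangent (𝓘N) ∞ (TotalSpace.proj : TangentBundle (𝓘N) N → N) :=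
    contMDiff_proj (TangentSpace (𝓘N))
  have h2 := ContMDiff.clm_bundle_apply (E₁ := TangentSpace (𝓘N) (M := N)) (F₁ := 𝔼)
    (E₂ := Bundle.Trivial N ℝ) (F₂ := ℝ) (IB := 𝓘N)
    (b := (TotalSpace.proj : TangentBundle (𝓘N) N → N)) (v := fun W => W.2)
    (α.smooth.comp h1) contMDiff_id
  intro W
  exact (Bundle.contMDiffAt_totalSpace.1 (h2 W)).2

/-- A contact form read in the chart at `x`. -/
def chartForm (α : ContactForm n N) (x : N) (y : 𝔼) : 𝔼 →L[ℝ] ℝ :=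
  (α.form ((extChartAt (𝓘N) x).symm y)).comp
    (mfderiv 𝓘(ℝ, 𝔼) (𝓘N) (extChartAt (𝓘N) x).symm y)

theorem contDiffOn_chartForm (α : ContactForm n N) (x : N) :
    ContDiffOn ℝ ∞ (α.chartForm x) (extChartAt (𝓘N) x).target := by
  rw [contDiffOn_clm_apply]
  intro w
  refine contMDiffOn_iff_contDiffOn.1 ?_
  have h1 := contMDiffOn_tangentMap (isOpen_extChartAt_target (I := 𝓘N) x)
    (contMDiffOn_extChartAt_symm (n := ∞) x)
  have h2 : ContMDiff 𝓘(ℝ, 𝔼) (𝓘(ℝ, 𝔼)).tangent ∞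
      (fun y : 𝔼 => (⟨y, w⟩ : TangentBundle 𝓘(ℝ, 𝔼) 𝔼)) :=
    contMDiff_vectorSpace_iff_contDiff.2 contDiff_const
  exact α.contMDiff_onTangent.comp_contMDiffOn (h1.comp h2.contMDiffOn fun y hy => hy)

theorem contDiffAt_chartForm (α : ContactForm n N) {x : N} {y : 𝔼}
    (hy : y ∈ (extChartAt (𝓘N) x).target) : ContDiffAt ℝ ∞ (α.chartForm x) y :=
  (α.contDiffOn_chartForm x).contDiffAt ((isOpen_extChartAt_target x).mem_nhds hy)

/-- The differential of the chart at `x`, at a point `z`. -/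
def chartD (x z : N) : 𝔼 →L[ℝ] 𝔼 := mfderiv (𝓘N) 𝓘(ℝ, 𝔼) (extChartAt (𝓘N) x) z

/-- The exterior derivative of a contact form can be computed in any chart. -/
theorem oneFormExtDeriv_eq (α : ContactForm n N) {x z : N}
    (hz : z ∈ (extChartAt (𝓘N) x).source) (u v : TangentSpace (𝓘N) z) :
    oneFormExtDeriv α.form z u v =
      oneFormCurl (α.chartForm x) (extChartAt (𝓘N) x z) (chartD x z u) (chartD x z v) := by
  set φ := extChartAt (𝓘N) x with hφ
  set φ' := extChartAt (𝓘N) z with hφ'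
  -- `oneFormExtDeriv` uses at each point the chart centred there. The transition map `T` pulls the
  -- form in the chart at `x` back to the form in the chart at `z`, and `d` commutes with pullback.
  let T : 𝔼 → 𝔼 := fun y => φ (φ'.symm y)
  have hz' : φ' z ∈ φ'.target := mem_extChartAt_target z
  have hzz : φ'.symm (φ' z) = z := extChartAt_to_inv z
  have hev : ∀ᶠ y in 𝓝 (φ' z), y ∈ φ'.target ∧ φ'.symm y ∈ φ.source := by
    refine Filter.Eventually.and ((isOpen_extChartAt_target z).mem_nhds hz') ?_
    apply (contMDiffAt_extChartAt_symm hz').continuousAt.eventually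
    refine (isOpen_extChartAt_source x).mem_nhds ?_
    exact (congrArg (· ∈ φ.source) hzz).mpr hz
  have hT : ∀ y, y ∈ φ'.target ∧ φ'.symm y ∈ φ.source → ContDiffAt ℝ ∞ T y := fun y hy =>
    contMDiffAt_iff_contDiffAt.1 (ContMDiffAt.comp (I' := 𝓘N) y
      (contMDiffAt_extChartAt_of_mem hy.2) (contMDiffAt_extChartAt_symm hy.1))
  have hTz : T (φ' z) = φ z := congrArg φ hzz
  have hform : α.chartForm z =ᶠ[𝓝 (φ' z)]
      fun y => (α.chartForm x (T y)).comp (fderiv ℝ T y) := by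
    filter_upwards [hev.eventually_nhds] with y hy
    have hy' := hy.self_of_nhds
    have hTy : T y ∈ φ.target := φ.map_source hy'.2
    ext w
    change α.onTangent (tangentMap 𝓘(ℝ, 𝔼) (𝓘N) φ'.symm ⟨y, w⟩) =
      α.onTangent (tangentMap 𝓘(ℝ, 𝔼) (𝓘N) φ.symm ⟨T y, fderiv ℝ T y w⟩)
    refine congrArg α.onTangent ?_
    have h1 : φ'.symm =ᶠ[𝓝 y] φ.symm ∘ T := hy.mono fun y' hy' => (φ.left_inv hy'.2).symm
    have h2 := tangentMap_comp_at (I := 𝓘(ℝ, 𝔼)) (I' := 𝓘(ℝ, 𝔼)) (I'' := 𝓘N)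
      (⟨y, w⟩ : TangentBundle 𝓘(ℝ, 𝔼) 𝔼)
      (g := φ.symm) (f := T) ((contMDiffAt_extChartAt_symm hTy).mdifferentiableAt (by simp))
      ((hT y hy').contMDiffAt.mdifferentiableAt (by simp))
    refine (tangentMap_congr h1 _).trans (h2.trans ?_)
    refine congrArg (tangentMap 𝓘(ℝ, 𝔼) (𝓘N) φ.symm) (tangentBundle_ext rfl ?_)
    exact DFunLike.congr_fun (mfderiv_eq_fderiv (f := T) (x := y)) w
  have hmf : ∀ w : 𝔼, fderiv ℝ T (φ' z) (chartD z z w) = chartD x z w := by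
    intro w
    have h1 : φ =ᶠ[𝓝 z] T ∘ φ' := by
      filter_upwards [extChartAt_source_mem_nhds (I := 𝓘N) z] with z' hz'
      exact congrArg φ (φ'.left_inv hz').symm
    have h2 : chartD x z = mfderiv (𝓘N) 𝓘(ℝ, 𝔼) (T ∘ φ') z := h1.mfderiv_eq
    have h3 := mfderiv_comp (I' := 𝓘(ℝ, 𝔼)) z
      ((hT _ hev.self_of_nhds).contMDiffAt.mdifferentiableAt (by simp))
      ((contMDiffAt_extChartAt (I := 𝓘N) (n := ∞) (x := z)).mdifferentiableAt (by simp))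
    have h4 := DFunLike.congr_fun (h2.trans h3) w
    rw [mfderiv_eq_fderiv] at h4
    exact h4.symm
  calc oneFormExtDeriv α.form z u v
      = oneFormCurl (α.chartForm z) (φ' z) (chartD z z u) (chartD z z v) :=
        extDeriv_ofSubsingleton ((α.contDiffAt_chartForm hz').differentiableAt (by simp)) _ _
    _ = oneFormCurl (fun y => (α.chartForm x (T y)).comp (fderiv ℝ T y)) (φ' z)
          (chartD z z u) (chartD z z v) := oneFormCurl_congr hform _ _
    _ = oneFormCurl (α.chartForm x) (T (φ' z)) (fderiv ℝ T (φ' z) (chartD z z u))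
          (fderiv ℝ T (φ' z) (chartD z z v)) :=
        oneFormCurl_pullback (by
          rw [hTz]
          exact (α.contDiffAt_chartForm (φ.map_source hz)).differentiableAt (by simp))
          (hT _ hev.self_of_nhds) _ _
    _ = _ := by
        rw [hTz]
        exact congrArg₂ (oneFormCurl (α.chartForm x) (φ z)) (hmf u) (hmf v)

end ContactForm

/-! ### Smoothness of the Reeb field -/

namespace ContactForm

variable {n : ℕ} {N : Type*} [TopologicalSpace N]
  [ChartedSpace (EuclideanSpace ℝ (Fin (2 * n + 1))) N] [IsManifold (𝓡 (2 * n + 1)) ∞ N]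

local notation "𝔼" => EuclideanSpace ℝ (Fin (2 * n + 1))
local notation "𝓘N" => 𝓡 (2 * n + 1)

/-- The differential of the inverse of the chart at `x`. -/
def chartSymmD (x : N) (y : 𝔼) : 𝔼 →L[ℝ] 𝔼 := mfderiv 𝓘(ℝ, 𝔼) (𝓘N) (extChartAt (𝓘N) x).symm y

theorem chartSymmD_chartD {x z : N} (hz : z ∈ (extChartAt (𝓘N) x).source) (w : 𝔼) :
    chartSymmD x (extChartAt (𝓘N) x z) (chartD x z w) = w :=
  mfderiv_extChartAt_symm_apply hz w

theorem chartD_chartSymmD {x : N} {y : 𝔼} (hy : y ∈ (extChartAt (𝓘N) x).target) (w : 𝔼) :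
    chartD x ((extChartAt (𝓘N) x).symm y) (chartSymmD x y w) = w :=
  mfderiv_extChartAt_apply hy w

theorem chartForm_chartD (α : ContactForm n N) {x z : N} (hz : z ∈ (extChartAt (𝓘N) x).source)
    (w : TangentSpace (𝓘N) z) :
    α.chartForm x (extChartAt (𝓘N) x z) (chartD x z w) = α.form z w := by
  change α.onTangent ⟨_, chartSymmD x (extChartAt (𝓘N) x z) (chartD x z w)⟩ = α.onTangent ⟨z, w⟩
  exact congrArg α.onTangent
    (tangentBundle_ext ((extChartAt (𝓘N) x).left_inv hz) (chartSymmD_chartD hz w))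

/-- The contact form in a chart is nondegenerate in the sense that `da + a ⊗ a` is. -/
theorem chartForm_nondegenerate (α : ContactForm n N) {x z : N}
    (hz : z ∈ (extChartAt (𝓘N) x).source) (w : 𝔼)
    (h0 : α.chartForm x (extChartAt (𝓘N) x z) w = 0)
    (h1 : ∀ v, oneFormCurl (α.chartForm x) (extChartAt (𝓘N) x z) w v = 0) : w = 0 := by
  have hy := (extChartAt (𝓘N) x).map_source hz
  have hw : chartD x z (chartSymmD x (extChartAt (𝓘N) x z) w) = w := by
    have h := chartD_chartSymmD hy w
    rwa [(extChartAt (𝓘N) x).left_inv hz] at h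
  have h := α.nondegenerate z (chartSymmD x (extChartAt (𝓘N) x z) w) ?_ ?_
  · rw [← hw]
    exact (congrArg (chartD x z) h).trans (map_zero _)
  · exact (α.chartForm_chartD hz _).symm.trans ((congrArg _ hw).trans h0)
  · intro v _
    refine (α.oneFormExtDeriv_eq hz _ _).trans ?_
    exact (congrArg (fun w => oneFormCurl (α.chartForm x) (extChartAt (𝓘N) x z) w _) hw).trans
      (h1 _)

omit [IsManifold (𝓡 (2 * n + 1)) ∞ N] in
theorem chartField_chartAt (v : ∀ x : N, TangentSpace (𝓘N) x) {x z : N}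
    (hz : z ∈ (extChartAt (𝓘N) x).source) :
    chartField v x (extChartAt (𝓘N) x z) = chartD x z (v z) := by
  -- The inverse chart returns to `z` only up to a provable equality, so the base point is
  -- generalised before rewriting.
  have h : ∀ z', z' = z → chartD x z' (v z') = chartD x z (v z) := by rintro _ rfl; rfl
  exact h _ ((extChartAt (𝓘N) x).left_inv hz)

theorem chartForm_chartField_reeb (α : ContactForm n N) {x z : N}
    (hz : z ∈ (extChartAt (𝓘N) x).source) :
    α.chartForm x (extChartAt (𝓘N) x z) (chartField α.reebField x (extChartAt (𝓘N) x z)) = 1 := by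
  rw [chartField_chartAt _ hz, α.chartForm_chartD hz]
  exact (α.reebField_spec z).1

theorem oneFormCurl_chartField_reeb (α : ContactForm n N) {x z : N}
    (hz : z ∈ (extChartAt (𝓘N) x).source) (w : 𝔼) :
    oneFormCurl (α.chartForm x) (extChartAt (𝓘N) x z)
      (chartField α.reebField x (extChartAt (𝓘N) x z)) w = 0 := by
  have h := (α.reebField_spec z).2 (chartSymmD x (extChartAt (𝓘N) x z) w)
  have h := (α.oneFormExtDeriv_eq hz _ _).symm.trans h
  have hw : chartD x z (chartSymmD x (extChartAt (𝓘N) x z) w) = w := by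
    have h := chartD_chartSymmD ((extChartAt (𝓘N) x).map_source hz) w
    rwa [(extChartAt (𝓘N) x).left_inv hz] at h
  rw [chartField_chartAt _ hz]
  exact (congrArg (oneFormCurl (α.chartForm x) (extChartAt (𝓘N) x z) _) hw).symm.trans h

theorem contDiffAt_chartField_reeb (α : ContactForm n N) {x z : N}
    (hz : z ∈ (extChartAt (𝓘N) x).source) :
    ContDiffAt ℝ ∞ (chartField α.reebField x) (extChartAt (𝓘N) x z) := by
  have hy := (extChartAt (𝓘N) x).map_source hz
  have hev : ∀ᶠ y in 𝓝 (extChartAt (𝓘N) x z), ∃ z' ∈ (extChartAt (𝓘N) x).source,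
      extChartAt (𝓘N) x z' = y := by
    filter_upwards [(isOpen_extChartAt_target (I := 𝓘N) x).mem_nhds hy] with y hy'
    exact ⟨_, (extChartAt (𝓘N) x).map_target hy', (extChartAt (𝓘N) x).right_inv hy'⟩
  refine contDiffAt_reeb (α.contDiffAt_chartForm hy) (hev.mono ?_) (hev.mono ?_)
  · rintro _ ⟨z', hz', rfl⟩
    exact α.chartForm_nondegenerate hz'
  · rintro _ ⟨z', hz', rfl⟩
    exact ⟨α.chartForm_chartField_reeb hz', α.oneFormCurl_chartField_reeb hz'⟩

/-- The Reeb field is smooth. -/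
theorem contMDiff_reebField (α : ContactForm n N) :
    ContMDiff (𝓘N) (𝓘N).tangent ∞
      (fun x => (⟨x, α.reebField x⟩ : TangentBundle (𝓘N) N)) := by
  intro x
  set φ := extChartAt (𝓘N) x with hφ
  have hxs : x ∈ φ.source := mem_extChartAt_source x
  have h1 : ContMDiffAt (𝓘N) (𝓘(ℝ, 𝔼)).tangent ∞
      (fun z => (⟨φ z, chartField α.reebField x (φ z)⟩ : TangentBundle 𝓘(ℝ, 𝔼) 𝔼)) x := by
    have h2 : ContMDiffAt 𝓘(ℝ, 𝔼) (𝓘(ℝ, 𝔼)).tangent ∞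
      (fun y => (⟨y, chartField α.reebField x y⟩ : TangentBundle 𝓘(ℝ, 𝔼) 𝔼)) (φ x) :=
      contMDiffAt_vectorSpace_iff_contDiffAt.2 (α.contDiffAt_chartField_reeb hxs)
    exact h2.comp x contMDiffAt_extChartAt
  have h3 := contMDiffOn_tangentMap (isOpen_extChartAt_target (I := 𝓘N) x)
    (contMDiffOn_extChartAt_symm (n := ∞) x)
  have h4 := (h3.contMDiffAt (x := ⟨φ x, chartField α.reebField x (φ x)⟩)
    (((isOpen_extChartAt_target (I := 𝓘N) x).preimage
      (FiberBundle.continuous_proj 𝔼 _)).mem_nhds (φ.map_source hxs))).comp x h1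
  refine h4.congr_of_eventuallyEq ?_
  filter_upwards [extChartAt_source_mem_nhds (I := 𝓘N) x] with z hz
  refine (tangentBundle_ext (φ.left_inv hz) ?_).symm
  exact (congrArg _ (chartField_chartAt α.reebField hz)).trans (chartSymmD_chartD hz _)

end ContactForm

/-! ### The Reeb flow -/

namespace ContactForm

variable {n : ℕ} {N : Type*} [TopologicalSpace N]
  [ChartedSpace (EuclideanSpace ℝ (Fin (2 * n + 1))) N] [IsManifold (𝓡 (2 * n + 1)) ∞ N]
  [CompactSpace N] [T2Space N]

local notation "𝔼" => EuclideanSpace ℝ (Fin (2 * n + 1))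
local notation "𝓘N" => 𝓡 (2 * n + 1)

/-- The flow of the Reeb field. -/
def reebFlow (α : ContactForm n N) : ℝ → N → N :=
  (exists_contMDiff_flow α.contMDiff_reebField).choose

theorem reebFlow_zero (α : ContactForm n N) (x : N) : α.reebFlow 0 x = x :=
  (exists_contMDiff_flow α.contMDiff_reebField).choose_spec.1 x

theorem reebFlow_add (α : ContactForm n N) (s t : ℝ) (x : N) :
    α.reebFlow (s + t) x = α.reebFlow s (α.reebFlow t x) :=
  (exists_contMDiff_flow α.contMDiff_reebField).choose_spec.2.1 s t x

theorem isMIntegralCurve_reebFlow (α : ContactForm n N) (x : N) :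
    IsMIntegralCurve (I := 𝓘N) (fun t => α.reebFlow t x) α.reebField :=
  (exists_contMDiff_flow α.contMDiff_reebField).choose_spec.2.2.1 x

theorem contMDiff_reebFlow (α : ContactForm n N) :
    ContMDiff (𝓘(ℝ).prod (𝓘N)) (𝓘N) ∞ (fun p : ℝ × N => α.reebFlow p.1 p.2) :=
  (exists_contMDiff_flow α.contMDiff_reebField).choose_spec.2.2.2

theorem contMDiff_reebFlow_apply (α : ContactForm n N) (t : ℝ) :
    ContMDiff (𝓘N) (𝓘N) ∞ (α.reebFlow t) :=
  α.contMDiff_reebFlow.comp (contMDiff_const.prodMk contMDiff_id)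

/-- Uniqueness of integral curves; it identifies the arbitrary curves in the definition of
`reebGroup` with the chosen flow. -/
theorem eq_reebFlow (α : ContactForm n N) {γ : ℝ → N}
    (hγ : IsMIntegralCurve (I := 𝓘N) γ α.reebField) (t : ℝ) : γ t = α.reebFlow t (γ 0) := by
  have : IsManifold (𝓘N) 1 N := .of_le (n := ∞) (by simp)
  exact congrFun (isMIntegralCurve_Ioo_eq_of_contMDiff_boundaryless (t₀ := 0)
    (α.contMDiff_reebField.of_le (by simp)) hγ (α.isMIntegralCurve_reebFlow (γ 0))
    (α.reebFlow_zero _).symm) t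

/-- The time `t` map of the Reeb flow as a diffeomorphism. -/
def reebDiffeo (α : ContactForm n N) (t : ℝ) : Diffeomorph (𝓘N) (𝓘N) N N ∞ where
  toFun := α.reebFlow t
  invFun := α.reebFlow (-t)
  left_inv x := by rw [← reebFlow_add, neg_add_cancel, reebFlow_zero]
  right_inv x := by rw [← reebFlow_add, add_neg_cancel, reebFlow_zero]
  contMDiff_toFun := α.contMDiff_reebFlow_apply t
  contMDiff_invFun := α.contMDiff_reebFlow_apply (-t)

theorem reebDiffeo_apply (α : ContactForm n N) (t : ℝ) (x : N) :
    α.reebDiffeo t x = α.reebFlow t x := rfl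

/-- With fixed charts at `x` and at the point reached at time `t₀`, the flow becomes a map `h(t, y)`
with `∂ₜ h` the Reeb field in the chart. The claim then reduces to `hasDerivAt_pullback_eq_zero`. -/
theorem hasDerivAt_onTangent_reebFlow (α : ContactForm n N) (x : N) (v : TangentSpace (𝓘N) x)
    (t₀ : ℝ) :
    HasDerivAt (fun t => α.onTangent (tangentMap (𝓘N) (𝓘N) (α.reebFlow t) ⟨x, v⟩)) 0 t₀ := by
  set z₀ := α.reebFlow t₀ x with hz₀
  set φ := extChartAt (𝓘N) x with hφ
  set φ' := extChartAt (𝓘N) z₀ with hφ'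
  obtain ⟨k, hk⟩ : ∃ k : ℝ × 𝔼 → N, k = fun p => α.reebFlow p.1 (φ.symm p.2) := ⟨_, rfl⟩
  obtain ⟨h, hh⟩ : ∃ h : ℝ × 𝔼 → 𝔼, h = fun p => φ' (k p) := ⟨_, rfl⟩
  have hkx : k (t₀, φ x) = z₀ := by
    rw [hk]
    exact congrArg (α.reebFlow t₀) (extChartAt_to_inv x)
  have hkd : ∀ p : ℝ × 𝔼, p.2 ∈ φ.target → ContMDiffAt 𝓘(ℝ, ℝ × 𝔼) (𝓘N) ∞ k p := by
    intro p hp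
    rw [hk]
    refine ContMDiffAt.comp (I' := 𝓘(ℝ).prod (𝓘N)) (g := fun p : ℝ × N => α.reebFlow p.1 p.2)
      (f := fun p : ℝ × 𝔼 => (p.1, φ.symm p.2)) p α.contMDiff_reebFlow.contMDiffAt ?_
    refine ContMDiffAt.prodMk contDiffAt_fst.contMDiffAt ?_
    exact ContMDiffAt.comp (I' := 𝓘(ℝ, 𝔼)) (g := φ.symm) p (contMDiffAt_extChartAt_symm hp)
      contDiffAt_snd.contMDiffAt
  have hxt : φ x ∈ φ.target := mem_extChartAt_target x
  have hev : ∀ᶠ p in 𝓝 (t₀, φ x), p.2 ∈ φ.target ∧ k p ∈ φ'.source := by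
    refine Filter.Eventually.and
      (continuousAt_snd.eventually ((isOpen_extChartAt_target x).mem_nhds hxt)) ?_
    refine (hkd (t₀, φ x) hxt).continuousAt.eventually ?_
    rw [hkx]
    exact extChartAt_source_mem_nhds z₀
  have hhd : ∀ p : ℝ × 𝔼, p.2 ∈ φ.target ∧ k p ∈ φ'.source → ContDiffAt ℝ ∞ h p := by
    intro p hp
    rw [hh]
    exact contMDiffAt_iff_contDiffAt.1 (ContMDiffAt.comp (I' := 𝓘N) (g := φ') p
      (contMDiffAt_extChartAt_of_mem hp.2) (hkd p hp.1))
  have hdt : ∀ p : ℝ × 𝔼, p.2 ∈ φ.target ∧ k p ∈ φ'.source →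
      fderiv ℝ h p (1, 0) = chartField α.reebField z₀ (φ' (k p)) := by
    rintro ⟨t, y⟩ hp
    have h1 : HasDerivAt (fun s : ℝ => h (s, y)) (fderiv ℝ h (t, y) (1, 0)) t :=
      ((hhd _ hp).differentiableAt (by simp)).hasFDerivAt.comp_hasDerivAt t
        ((hasDerivAt_id t).prodMk (hasDerivAt_const t y))
    have h2 := α.isMIntegralCurve_reebFlow (φ.symm y) t
    have hp2 : α.reebFlow t (φ.symm y) ∈ φ'.source := by
      have := hp.2
      rwa [hk] at this
    have h3 := ((contMDiffAt_extChartAt_of_mem hp2).mdifferentiableAt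
      (by simp)).hasMFDerivAt.comp t h2
    have h4 : HasDerivAt (fun s : ℝ => h (s, y))
        (chartD z₀ (α.reebFlow t (φ.symm y)) (α.reebField (α.reebFlow t (φ.symm y)))) t := by
      rw [hh, hk]
      have h5 : HasFDerivAt (fun s : ℝ => φ' (α.reebFlow s (φ.symm y)))
          ((chartD z₀ (α.reebFlow t (φ.symm y))).comp ((1 : ℝ →L[ℝ] ℝ).smulRight
            (α.reebField (α.reebFlow t (φ.symm y)) : 𝔼)) : ℝ →L[ℝ] 𝔼) t :=
        hasMFDerivAt_iff_hasFDerivAt.1 h3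
      refine h5.hasDerivAt.congr_deriv ?_
      exact congrArg (chartD z₀ (α.reebFlow t (φ.symm y))) (one_smul ℝ (_ : 𝔼))
    rw [h1.unique h4, hk]
    exact (chartField_chartAt α.reebField hp2).symm
  have key := hasDerivAt_pullback_eq_zero (a := α.chartForm z₀) (h := h) (t₀ := t₀) (y₀ := φ x)
    (by
      rw [hh]
      exact (α.contDiffAt_chartForm (φ'.map_source hev.self_of_nhds.2)).differentiableAt (by simp))
    (hhd _ hev.self_of_nhds)
    (hev.mono fun p hp => by
      rw [hdt p hp, hh]
      exact α.chartForm_chartField_reeb hp.2)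
    (fun w => by
      rw [hdt _ hev.self_of_nhds, hh]
      exact α.oneFormCurl_chartField_reeb hev.self_of_nhds.2 w)
    (chartD x x v)
  refine key.congr_of_eventuallyEq ?_
  have hct : ContinuousAt (fun t : ℝ => (t, φ x)) t₀ := by fun_prop
  filter_upwards [hct.eventually hev.eventually_nhds] with t ht
  have ht0 := ht.self_of_nhds
  have hcz : ContinuousAt (fun z => (t, φ z)) x :=
    continuousAt_const.prodMk (continuousAt_extChartAt x)
  have heq : α.reebFlow t =ᶠ[𝓝 x] φ'.symm ∘ ((fun y => h (t, y)) ∘ φ) := by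
    filter_upwards [hcz.eventually ht, extChartAt_source_mem_nhds (I := 𝓘N) x] with z hz hzs
    have h1 := φ'.left_inv hz.2
    rw [hk] at h1
    simp only [Function.comp_apply, hh, hk, φ.left_inv hzs] at h1 ⊢
    exact h1.symm
  have hslice : HasFDerivAt (fun y => h (t, y))
      ((fderiv ℝ h (t, φ x)).comp (ContinuousLinearMap.inr ℝ ℝ 𝔼)) (φ x) :=
    ((hhd _ ht0).differentiableAt (by simp)).hasFDerivAt.comp (φ x) (hasFDerivAt_prodMk_right t _)
  have hsymm : MDifferentiableAt 𝓘(ℝ, 𝔼) (𝓘N) φ'.symm (h (t, φ x)) := by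
    refine (contMDiffAt_extChartAt_symm ?_).mdifferentiableAt (n := ∞) (by simp)
    rw [hh]
    exact φ'.map_source ht0.2
  have hφd : MDifferentiableAt (𝓘N) 𝓘(ℝ, 𝔼) φ x :=
    (contMDiffAt_extChartAt (n := ∞)).mdifferentiableAt (by simp)
  have hsd : MDifferentiableAt 𝓘(ℝ, 𝔼) 𝓘(ℝ, 𝔼) (fun y => h (t, y)) (φ x) :=
    hslice.differentiableAt.mdifferentiableAt
  have e1 := tangentMap_comp_at (I := 𝓘N) (I' := 𝓘(ℝ, 𝔼)) (I'' := 𝓘N)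
    (⟨x, v⟩ : TangentBundle (𝓘N) N) (g := φ'.symm) (f := (fun y => h (t, y)) ∘ φ) hsymm
    (hsd.comp x hφd)
  have e2 := tangentMap_comp_at (I := 𝓘N) (I' := 𝓘(ℝ, 𝔼)) (I'' := 𝓘(ℝ, 𝔼))
    (⟨x, v⟩ : TangentBundle (𝓘N) N) (g := fun y => h (t, y)) (f := φ) hsd hφd
  have e3 : tangentMap 𝓘(ℝ, 𝔼) 𝓘(ℝ, 𝔼) (fun y => h (t, y))
      (tangentMap (𝓘N) 𝓘(ℝ, 𝔼) φ ⟨x, v⟩) =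
      ⟨h (t, φ x), fderiv ℝ h (t, φ x) (0, chartD x x v)⟩ :=
    tangentBundle_ext rfl (DFunLike.congr_fun hslice.hasMFDerivAt.mfderiv (chartD x x v))
  refine (congrArg α.onTangent ((tangentMap_congr heq v).trans (e1.trans
    (congrArg (tangentMap 𝓘(ℝ, 𝔼) (𝓘N) φ'.symm) (e2.trans e3))))).trans ?_
  rfl

/-- The Reeb flow preserves the contact form. -/
theorem onTangent_reebFlow (α : ContactForm n N) (t : ℝ) (W : TangentBundle (𝓘N) N) :
    α.onTangent (tangentMap (𝓘N) (𝓘N) (α.reebFlow t) W) = α.onTangent W := by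
  obtain ⟨x, v⟩ := W
  have h := is_const_of_deriv_eq_zero
    (fun s => (α.hasDerivAt_onTangent_reebFlow x v s).differentiableAt)
    (fun s => (α.hasDerivAt_onTangent_reebFlow x v s).deriv) t 0
  have h0 : α.reebFlow 0 = id := funext α.reebFlow_zero
  simp only [h0, tangentMap_id] at h
  exact h

theorem form_mfderiv_reebFlow (α : ContactForm n N) (t : ℝ) (x : N) (v : TangentSpace (𝓘N) x) :
    α.form (α.reebFlow t x) (mfderiv (𝓘N) (𝓘N) (α.reebFlow t) x v) = α.form x v :=
  α.onTangent_reebFlow t ⟨x, v⟩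

theorem isContactomorphism_reebDiffeo (α : ContactForm n N) (t : ℝ) :
    α.IsContactomorphism (α.reebDiffeo t) := by
  intro x
  refine ⟨?_, fun v hv => ?_⟩
  · ext w
    constructor
    · rintro ⟨v, hv, rfl⟩
      exact (α.form_mfderiv_reebFlow t x v).trans hv
    · intro hw
      have hsurj : Function.Surjective (mfderiv (𝓘N) (𝓘N) (α.reebDiffeo t) x) :=
        ((α.reebDiffeo t).mfderivToContinuousLinearEquiv (by simp) x).surjective
      obtain ⟨v, rfl⟩ := hsurj w
      exact ⟨v, (α.form_mfderiv_reebFlow t x v).symm.trans hw, rfl⟩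
  · exact hv.trans_eq (α.form_mfderiv_reebFlow t x v).symm

end ContactForm

/-! ### Hamiltonians of contact isotopies -/

namespace ContactForm

variable {n : ℕ} {N : Type*} [TopologicalSpace N]
  [ChartedSpace (EuclideanSpace ℝ (Fin (2 * n + 1))) N] [IsManifold (𝓡 (2 * n + 1)) ∞ N]

local notation "𝔼" => EuclideanSpace ℝ (Fin (2 * n + 1))
local notation "𝓘N" => 𝓡 (2 * n + 1)

namespace ContactIsotopy

variable {α : ContactForm n N}

/-- The contact Hamiltonian at the moving point `ψ_t(x)`. -/
def alphaVelocity (Ψ : α.ContactIsotopy) (t : ℝ) (x : N) : ℝ :=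
  α.onTangent ⟨Ψ.toFun t x, Ψ.velocity t x⟩

theorem uniqueMDiffWithinAt_Icc {t : ℝ} (ht : t ∈ Icc (0 : ℝ) 1) :
    UniqueMDiffWithinAt 𝓘(ℝ) (Icc (0 : ℝ) 1) t :=
  (uniqueDiffOn_Icc one_pos t ht).uniqueMDiffWithinAt

theorem hasMFDerivWithinAt_velocity (Ψ : α.ContactIsotopy) {t : ℝ} (ht : t ∈ Icc (0 : ℝ) 1)
    (x : N) :
    HasMFDerivWithinAt 𝓘(ℝ) (𝓘N) (fun s => Ψ.toFun s x) (Icc 0 1) t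
      ((1 : ℝ →L[ℝ] ℝ).smulRight (Ψ.velocity t x : 𝔼)) := by
  have h1 : ContMDiffOn 𝓘(ℝ) (𝓘N) ∞ (fun s => Ψ.toFun s x) (Icc 0 1) :=
    Ψ.smooth.comp (contMDiff_id.prodMk contMDiff_const).contMDiffOn fun s hs => ⟨hs, mem_univ _⟩
  refine ((h1 t ht).mdifferentiableWithinAt (by simp)).hasMFDerivWithinAt.congr_mfderiv ?_
  exact ContinuousLinearMap.ext_ring (one_smul ℝ (_ : 𝔼)).symm

theorem hasMFDerivWithinAt_reparam (Ψ : α.ContactIsotopy) {β : ℝ → ℝ} {b t : ℝ}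
    (hβ : ∀ s ∈ Icc (0 : ℝ) 1, β s ∈ Icc (0 : ℝ) 1) (ht : t ∈ Icc (0 : ℝ) 1)
    (hb : HasDerivAt β b t) (x : N) :
    HasMFDerivWithinAt 𝓘(ℝ) (𝓘N) (fun s => Ψ.toFun (β s) x) (Icc 0 1) t
      ((1 : ℝ →L[ℝ] ℝ).smulRight (b • (Ψ.velocity (β t) x : 𝔼))) := by
  have h := (Ψ.hasMFDerivWithinAt_velocity (hβ t ht) x).comp t
    hb.hasFDerivAt.hasMFDerivAt.hasMFDerivWithinAt hβ
  refine h.congr_mfderiv (ContinuousLinearMap.ext_ring ?_)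
  change ((1 : ℝ) • b) • (Ψ.velocity (β t) x : 𝔼) = (1 : ℝ) • (b • (Ψ.velocity (β t) x : 𝔼))
  rw [one_smul, one_smul]

/-- The velocity of an isotopy is a value of the tangent map of `(t, x) ↦ ψ_t(x)`. -/
theorem velocity_eq_tangentMapWithin (Ψ : α.ContactIsotopy) {t : ℝ} (ht : t ∈ Icc (0 : ℝ) 1)
    (x : N) :
    tangentMapWithin (𝓘(ℝ).prod (𝓘N)) (𝓘N) (fun p : ℝ × N => Ψ.toFun p.1 p.2)
      (Icc (0 : ℝ) 1 ×ˢ univ) ⟨(t, x), ((1 : ℝ), (0 : 𝔼))⟩ =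
      ⟨Ψ.toFun t x, Ψ.velocity t x⟩ := by
  refine tangentBundle_ext rfl ?_
  have h1 := ((Ψ.smooth (t, x) ⟨ht, mem_univ _⟩).mdifferentiableWithinAt
    (by simp)).hasMFDerivWithinAt
  have h2 : HasMFDerivWithinAt 𝓘(ℝ) (𝓘(ℝ).prod (𝓘N)) (fun s : ℝ => (s, x)) (Icc 0 1) t
      (ContinuousLinearMap.inl ℝ ℝ 𝔼) := by
    have h3 : MDifferentiableAt 𝓘(ℝ) (𝓘(ℝ).prod (𝓘N)) (fun s : ℝ => (s, x)) t :=
      mdifferentiableAt_id.prodMk mdifferentiableAt_const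
    have h4 := h3.hasMFDerivAt
    rw [mfderiv_prod_left] at h4
    exact h4.hasMFDerivWithinAt
  have h5 := h1.comp t h2 (show Icc (0 : ℝ) 1 ⊆ (fun s : ℝ => (s, x)) ⁻¹' (Icc (0 : ℝ) 1 ×ˢ univ)
    from fun s hs => mk_mem_prod hs (mem_univ _))
  exact (DFunLike.congr_fun (h5.mfderivWithin (uniqueMDiffWithinAt_Icc ht)) (1 : ℝ)).symm

/-- The velocity is the tangent map of `(t, x) ↦ ψ_t(x)` evaluated on the continuous field `(1, 0)`.
Joint continuity makes the suprema over `N` finite and continuous in time, so the energy integrals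
are genuine. -/
theorem continuousOn_alphaVelocity (Ψ : α.ContactIsotopy) :
    ContinuousOn (fun p : ℝ × N => Ψ.alphaVelocity p.1 p.2) (Icc (0 : ℝ) 1 ×ˢ univ) := by
  have : IsManifold (𝓘N) 1 N := .of_le (n := ∞) (by simp)
  have hu : UniqueMDiffOn (𝓘(ℝ).prod (𝓘N)) (Icc (0 : ℝ) 1 ×ˢ (univ : Set N)) :=
    (uniqueMDiffOn_iff_uniqueDiffOn.2 (uniqueDiffOn_Icc one_pos)).prod uniqueMDiffOn_univ
  have h1 := Ψ.smooth.continuousOn_tangentMapWithin (by simp) hu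
  have h2 : Continuous (fun p : ℝ × N =>
      (⟨p, ((1 : ℝ), (0 : 𝔼))⟩ : TangentBundle (𝓘(ℝ).prod (𝓘N)) (ℝ × N))) := by
    have h3 : Continuous (fun p : ℝ × N => (⟨p.1, (1 : ℝ)⟩ : TangentBundle 𝓘(ℝ) ℝ)) := by
      have h5 : ContMDiff 𝓘(ℝ) (𝓘(ℝ)).tangent ∞
          (fun y : ℝ => (⟨y, (1 : ℝ)⟩ : TangentBundle 𝓘(ℝ) ℝ)) :=
        contMDiff_vectorSpace_iff_contDiff.2 contDiff_const
      exact h5.continuous.comp continuous_fst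
    have h4 : Continuous (fun p : ℝ × N => (⟨p.2, (0 : 𝔼)⟩ : TangentBundle (𝓘N) N)) :=
      (Bundle.contMDiff_zeroSection ℝ (TangentSpace (𝓘N) (M := N)) (n := ∞)
        (IB := 𝓘N)).continuous.comp continuous_snd
    exact (contMDiff_equivTangentBundleProd_symm (n := ∞) (I := 𝓘(ℝ)) (I' := 𝓘N) (M := ℝ)
      (M' := N)).continuous.comp (h3.prodMk h4)
  have h6 := α.contMDiff_onTangent.continuous.comp_continuousOn
    (h1.comp h2.continuousOn fun p hp => hp)
  refine h6.congr fun p hp => ?_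
  exact (congrArg α.onTangent (Ψ.velocity_eq_tangentMapWithin hp.1 p.2)).symm

end ContactIsotopy

variable [CompactSpace N] [T2Space N]

/-- Moving a curve by the Reeb flow shifts its `α`-velocity by the speed of the flow. -/
theorem onTangent_reebFlow_comp (α : ContactForm n N) {k : ℝ → N} {k' : 𝔼} {C : ℝ → ℝ} {c t : ℝ}
    (ht : t ∈ Icc (0 : ℝ) 1) (hk : HasMFDerivWithinAt 𝓘(ℝ) (𝓘N) k (Icc 0 1) t
      ((1 : ℝ →L[ℝ] ℝ).smulRight k')) (hC : HasDerivAt C c t) :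
    α.onTangent ⟨α.reebFlow (C t) (k t),
      mfderivWithin 𝓘(ℝ) (𝓘N) (fun s => α.reebFlow (C s) (k s)) (Icc 0 1) t (1 : ℝ)⟩ =
      c + α.onTangent ⟨k t, k'⟩ := by
  have hΦ : MDifferentiableAt (𝓘(ℝ).prod (𝓘N)) (𝓘N) (fun p : ℝ × N => α.reebFlow p.1 p.2)
      (C t, k t) := α.contMDiff_reebFlow.mdifferentiableAt (by simp)
  have hP : HasMFDerivWithinAt 𝓘(ℝ) (𝓘(ℝ).prod (𝓘N)) (fun s => (C s, k s)) (Icc 0 1) t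
      (((1 : ℝ →L[ℝ] ℝ).smulRight c).prod ((1 : ℝ →L[ℝ] ℝ).smulRight k')) :=
    hC.hasFDerivAt.hasMFDerivAt.hasMFDerivWithinAt.prodMk hk
  have h1 := (hΦ.hasMFDerivAt.comp_hasMFDerivWithinAt t hP).mfderivWithin
    (ContactIsotopy.uniqueMDiffWithinAt_Icc ht)
  have h2 := mfderiv_prod_eq_add_apply (v := ((1 : ℝ) • c, (1 : ℝ) • k')) hΦ
  have h3 := (α.isMIntegralCurve_reebFlow (k t) (C t)).mfderiv
  -- The velocity splits into `C' R` and the image of `k'` under the Reeb flow. Since the flow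
  -- preserves `α`, their `α`-values are `c` and `α(k')`.
  have h4 : (mfderivWithin 𝓘(ℝ) (𝓘N) (fun s => α.reebFlow (C s) (k s)) (Icc 0 1) t (1 : ℝ) : 𝔼) =
      c • (α.reebField (α.reebFlow (C t) (k t)) : 𝔼) +
        (mfderiv (𝓘N) (𝓘N) (α.reebFlow (C t)) (k t) : 𝔼 →L[ℝ] 𝔼) k' := by
    refine (DFunLike.congr_fun h1 (1 : ℝ)).trans (h2.trans ?_)
    refine congrArg₂ (fun a b : 𝔼 => a + b) ?_ ?_
    · refine (DFunLike.congr_fun h3 ((1 : ℝ) • c)).trans ?_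
      exact congrArg (fun r : ℝ => r • (α.reebField (α.reebFlow (C t) (k t)) : 𝔼))
        (one_smul ℝ c)
    · exact congrArg (mfderiv (𝓘N) (𝓘N) (α.reebFlow (C t)) (k t) : 𝔼 →L[ℝ] 𝔼) (one_smul ℝ k')
  refine (congrArg (fun w : 𝔼 => α.onTangent ⟨α.reebFlow (C t) (k t), w⟩) h4).trans ?_
  have h5 := α.form_mfderiv_reebFlow (C t) (k t) k'
  have h6 := (α.reebField_spec (α.reebFlow (C t) (k t))).1
  refine ((α.form (α.reebFlow (C t) (k t))).map_add _ _).trans (congrArg₂ (· + ·) ?_ h5)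
  refine ((α.form (α.reebFlow (C t) (k t))).map_smul c _).trans ?_
  rw [h6, smul_eq_mul, mul_one]

end ContactForm

/-! ### Energies and the closure of the Reeb flow -/

section CompactSup

variable {N : Type*} [TopologicalSpace N] [CompactSpace N]

theorem continuousOn_ciSup_of_compact {f : ℝ → N → ℝ} {s : Set ℝ}
    (hf : ContinuousOn (fun p : ℝ × N => f p.1 p.2) (s ×ˢ univ)) :
    ContinuousOn (fun t => ⨆ x, f t x) s := by
  rw [continuousOn_iff_continuous_domRestrict]
  have h1 : Continuous (fun p : s × N => f p.1 p.2) :=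
    hf.comp_continuous (f := fun p : s × N => ((p.1 : ℝ), p.2)) (by fun_prop)
      fun p => ⟨p.1.2, mem_univ _⟩
  have h2 := isCompact_univ.continuous_sSup (K := (univ : Set N))
    (f := fun (t : s) (x : N) => f t x) h1
  simp only [image_univ] at h2
  exact h2

theorem bddAbove_range_of_compact {f : ℝ → N → ℝ} {s : Set ℝ}
    (hf : ContinuousOn (fun p : ℝ × N => f p.1 p.2) (s ×ˢ univ)) {t : ℝ} (ht : t ∈ s) :
    BddAbove (range (f t)) :=
  (isCompact_range (hf.comp_continuous (f := fun x : N => (t, x)) (by fun_prop)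
    fun _ => ⟨ht, mem_univ _⟩)).bddAbove

end CompactSup

namespace ContactForm

variable {n : ℕ} {N : Type*} [TopologicalSpace N]
  [ChartedSpace (EuclideanSpace ℝ (Fin (2 * n + 1))) N] [IsManifold (𝓡 (2 * n + 1)) ∞ N]

local notation "𝔼" => EuclideanSpace ℝ (Fin (2 * n + 1))
local notation "𝓘N" => 𝓡 (2 * n + 1)

/-! ### Energies estimated through continuous majorants -/

section Energy

variable {α : ContactForm n N}

namespace ContactIsotopy

/-- The bijection `ψ_t⁻¹` reindexes the supremum. The cases needed are `f` the identity, negation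
and absolute value. -/
theorem ciSup_comp_hamiltonian (Ψ : α.ContactIsotopy) (t : ℝ) (f : ℝ → ℝ) :
    ⨆ y, f (Ψ.hamiltonian t y) = ⨆ x, f (Ψ.alphaVelocity t x) :=
  (Ψ.toFun t).symm.toEquiv.iSup_comp (g := fun x => f (Ψ.alphaVelocity t x))

theorem ciSup_sub_ciInf_hamiltonian (Ψ : α.ContactIsotopy) (t : ℝ) :
    (⨆ y, Ψ.hamiltonian t y) - ⨅ y, Ψ.hamiltonian t y =
      (⨆ x, Ψ.alphaVelocity t x) + ⨆ x, -Ψ.alphaVelocity t x := by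
  have h : ⨅ y, Ψ.hamiltonian t y = -⨆ y, -Ψ.hamiltonian t y := by
    rw [iInf, Real.sInf_def, Set.neg_range, iSup]
  rw [h, sub_neg_eq_add]
  exact congrArg₂ (· + ·) (Ψ.ciSup_comp_hamiltonian t id) (Ψ.ciSup_comp_hamiltonian t Neg.neg)

variable [CompactSpace N]

theorem continuousOn_ciSup_abs (Ψ : α.ContactIsotopy) :
    ContinuousOn (fun t => ⨆ x, |Ψ.alphaVelocity t x|) (Icc 0 1) :=
  continuousOn_ciSup_of_compact Ψ.continuousOn_alphaVelocity.abs

theorem continuousOn_ciSup_add_ciSup_neg (Ψ : α.ContactIsotopy) :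
    ContinuousOn (fun t => (⨆ x, Ψ.alphaVelocity t x) + ⨆ x, -Ψ.alphaVelocity t x) (Icc 0 1) :=
  (continuousOn_ciSup_of_compact Ψ.continuousOn_alphaVelocity).add
    (continuousOn_ciSup_of_compact Ψ.continuousOn_alphaVelocity.neg)

theorem abs_alphaVelocity_le (Ψ : α.ContactIsotopy) {t : ℝ} (ht : t ∈ Icc (0 : ℝ) 1) (x : N) :
    |Ψ.alphaVelocity t x| ≤ ⨆ x, |Ψ.alphaVelocity t x| :=
  le_ciSup (bddAbove_range_of_compact (f := fun t x => |Ψ.alphaVelocity t x|)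
    Ψ.continuousOn_alphaVelocity.abs ht) x

theorem alphaVelocity_sub_le (Ψ : α.ContactIsotopy) {t : ℝ} (ht : t ∈ Icc (0 : ℝ) 1) (x y : N) :
    Ψ.alphaVelocity t x - Ψ.alphaVelocity t y ≤
      (⨆ x, Ψ.alphaVelocity t x) + ⨆ x, -Ψ.alphaVelocity t x :=
  add_le_add (le_ciSup (bddAbove_range_of_compact Ψ.continuousOn_alphaVelocity ht) x)
    (le_ciSup (bddAbove_range_of_compact (f := fun t x => -Ψ.alphaVelocity t x)
      Ψ.continuousOn_alphaVelocity.neg ht) y)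

end ContactIsotopy

theorem isContactomorphism_of_mem {ψ : Diffeomorph (𝓘N) (𝓘N) N N ∞} (h : ψ ∈ α.contactGroup) :
    α.IsContactomorphism ψ := by
  obtain ⟨Ψ, rfl⟩ := h
  exact Ψ.contact 1 (by simp)

theorem nonempty_isotopy (ψ : α.contactGroup) :
    Nonempty {Ψ : α.ContactIsotopy // Ψ.toFun 1 = ψ.1} :=
  ⟨⟨ψ.2.choose, ψ.2.choose_spec⟩⟩

/-- Together with `exists_isotopy_of_oscEnergy_lt`, `hoferEnergy_le` and `oscEnergy_le`, this
replaces suprema under the integral by a pointwise continuous majorant `g`. -/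
theorem exists_isotopy_of_hoferEnergy_lt [CompactSpace N] {ψ : α.contactGroup} {ε : ℝ}
    (h : α.hoferEnergy ψ < ε) :
    ∃ Ψ : α.ContactIsotopy, Ψ.toFun 1 = ψ.1 ∧ ∃ g : ℝ → ℝ, ContinuousOn g (Icc 0 1) ∧
      ∫ t in (0 : ℝ)..1, g t < ε ∧ ∀ t ∈ Icc (0 : ℝ) 1, ∀ x, |Ψ.alphaVelocity t x| ≤ g t := by
  have := nonempty_isotopy ψ
  obtain ⟨⟨Ψ, hΨ⟩, h1⟩ := exists_lt_of_ciInf_lt h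
  simp only [Ψ.ciSup_comp_hamiltonian _ abs] at h1
  exact ⟨Ψ, hΨ, _, Ψ.continuousOn_ciSup_abs, h1, fun t ht x => Ψ.abs_alphaVelocity_le ht x⟩

theorem exists_isotopy_of_oscEnergy_lt [CompactSpace N] {ψ : α.contactGroup} {ε : ℝ}
    (h : α.oscEnergy ψ < ε) :
    ∃ Ψ : α.ContactIsotopy, Ψ.toFun 1 = ψ.1 ∧ ∃ g : ℝ → ℝ, ContinuousOn g (Icc 0 1) ∧
      ∫ t in (0 : ℝ)..1, g t < ε ∧
      ∀ t ∈ Icc (0 : ℝ) 1, ∀ x y, Ψ.alphaVelocity t x - Ψ.alphaVelocity t y ≤ g t := by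
  have := nonempty_isotopy ψ
  obtain ⟨⟨Ψ, hΨ⟩, h1⟩ := exists_lt_of_ciInf_lt h
  simp only [Ψ.ciSup_sub_ciInf_hamiltonian] at h1
  exact ⟨Ψ, hΨ, _, Ψ.continuousOn_ciSup_add_ciSup_neg, h1,
    fun t ht x y => Ψ.alphaVelocity_sub_le ht x y⟩

theorem hoferEnergy_le [CompactSpace N] [Nonempty N] {ψ : α.contactGroup} (Ψ : α.ContactIsotopy)
    (hΨ : Ψ.toFun 1 = ψ.1) {g : ℝ → ℝ} (hg : ContinuousOn g (Icc 0 1))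
    (h : ∀ t ∈ Icc (0 : ℝ) 1, ∀ x, |Ψ.alphaVelocity t x| ≤ g t) :
    α.hoferEnergy ψ ≤ ∫ t in (0 : ℝ)..1, g t := by
  -- An infimum of reals lies below its terms only when the family is bounded below.
  have hb : BddBelow (range fun Ψ : {Ψ : α.ContactIsotopy // Ψ.toFun 1 = ψ.1} =>
      ∫ t in (0 : ℝ)..1, ⨆ y : N, |Ψ.1.hamiltonian t y|) := by
    refine ⟨0, ?_⟩
    rintro _ ⟨Ψ, rfl⟩
    exact intervalIntegral.integral_nonneg zero_le_one
      fun t _ => Real.iSup_nonneg fun y => abs_nonneg _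
  refine (ciInf_le hb ⟨Ψ, hΨ⟩).trans ?_
  simp only [Ψ.ciSup_comp_hamiltonian _ abs]
  exact intervalIntegral.integral_mono_on zero_le_one
    (Ψ.continuousOn_ciSup_abs.intervalIntegrable_of_Icc zero_le_one)
    (hg.intervalIntegrable_of_Icc zero_le_one) fun t ht => ciSup_le (h t ht)

theorem ContactIsotopy.integral_osc_nonneg [CompactSpace N] [Nonempty N] (Ψ : α.ContactIsotopy) :
    0 ≤ ∫ t in (0 : ℝ)..1, ((⨆ y : N, Ψ.hamiltonian t y) - ⨅ y : N, Ψ.hamiltonian t y) := by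
  simp only [Ψ.ciSup_sub_ciInf_hamiltonian]
  refine intervalIntegral.integral_nonneg zero_le_one fun t ht => ?_
  obtain ⟨x⟩ := ‹Nonempty N›
  exact (sub_self _).symm.trans_le (Ψ.alphaVelocity_sub_le ht x x)

theorem oscEnergy_nonneg [CompactSpace N] [Nonempty N] (ψ : α.contactGroup) :
    0 ≤ α.oscEnergy ψ :=
  have := nonempty_isotopy ψ
  le_ciInf fun Ψ => Ψ.1.integral_osc_nonneg

theorem oscEnergy_le [CompactSpace N] [Nonempty N] {ψ : α.contactGroup} (Ψ : α.ContactIsotopy)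
    (hΨ : Ψ.toFun 1 = ψ.1) {g : ℝ → ℝ} (hg : ContinuousOn g (Icc 0 1))
    (h : ∀ t ∈ Icc (0 : ℝ) 1, ∀ x y, Ψ.alphaVelocity t x - Ψ.alphaVelocity t y ≤ g t) :
    α.oscEnergy ψ ≤ ∫ t in (0 : ℝ)..1, g t := by
  have hb : BddBelow (range fun Ψ : {Ψ : α.ContactIsotopy // Ψ.toFun 1 = ψ.1} =>
      ∫ t in (0 : ℝ)..1, ((⨆ y : N, Ψ.1.hamiltonian t y) - ⨅ y : N, Ψ.1.hamiltonian t y)) := by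
    refine ⟨0, ?_⟩
    rintro _ ⟨Ψ, rfl⟩
    exact Ψ.1.integral_osc_nonneg
  refine (ciInf_le hb ⟨Ψ, hΨ⟩).trans ?_
  simp only [Ψ.ciSup_sub_ciInf_hamiltonian]
  refine intervalIntegral.integral_mono_on zero_le_one
    (Ψ.continuousOn_ciSup_add_ciSup_neg.intervalIntegrable_of_Icc zero_le_one)
    (hg.intervalIntegrable_of_Icc zero_le_one) fun t ht => ?_
  rw [← le_sub_iff_add_le]
  refine ciSup_le fun x => ?_
  rw [le_sub_iff_add_le, add_comm, ← le_sub_iff_add_le]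
  refine ciSup_le fun y => ?_
  linarith [h t ht x y]

end Energy

/-! ### Operations on contact isotopies -/

section Operations

variable {α : ContactForm n N}

namespace ContactIsotopy

/-- Derivatives within `[0, 1]` are unique, also at the end points, where they are one-sided. -/
theorem alphaVelocity_eq (Ψ : α.ContactIsotopy) {t : ℝ} (ht : t ∈ Icc (0 : ℝ) 1) {x : N} {w : 𝔼}
    (h : HasMFDerivWithinAt 𝓘(ℝ) (𝓘N) (fun s => Ψ.toFun s x) (Icc 0 1) t
      ((1 : ℝ →L[ℝ] ℝ).smulRight w)) :
    Ψ.alphaVelocity t x = α.onTangent ⟨Ψ.toFun t x, w⟩ := by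
  have h1 : (Ψ.velocity t x : 𝔼) = w :=
    (DFunLike.congr_fun (h.mfderivWithin (uniqueMDiffWithinAt_Icc ht)) (1 : ℝ)).trans
      (one_smul ℝ w)
  exact congrArg (fun w : 𝔼 => α.onTangent ⟨Ψ.toFun t x, w⟩) h1

/-- The constant isotopy. -/
def refl (α : ContactForm n N) : α.ContactIsotopy where
  toFun _ := 1
  zero := rfl
  contact _ _ := α.isContactomorphism_one
  smooth := contMDiff_snd.contMDiffOn

theorem alphaVelocity_refl {t : ℝ} (ht : t ∈ Icc (0 : ℝ) 1) (x : N) :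
    (refl α).alphaVelocity t x = 0 := by
  have h : HasMFDerivWithinAt 𝓘(ℝ) (𝓘N) (fun s => (refl α).toFun s x) (Icc 0 1) t
      ((1 : ℝ →L[ℝ] ℝ).smulRight (0 : 𝔼)) :=
    (hasMFDerivWithinAt_const x (Icc 0 1) t).congr_mfderiv
      (ContinuousLinearMap.ext_ring (smul_zero (1 : ℝ)).symm)
  exact (alphaVelocity_eq _ ht h).trans (map_zero (α.form _))

/-- If near `t` the isotopy `Θ` moves `x` as the reparametrized isotopy `Ψ ∘ β` moves `z`, then
its `α`-velocity is that of `Ψ` rescaled by the speed of `β`. -/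
theorem alphaVelocity_eq_of_reparam (Θ Ψ : α.ContactIsotopy) {β : ℝ → ℝ} {b t : ℝ} {x z : N}
    (hβ : ∀ s ∈ Icc (0 : ℝ) 1, β s ∈ Icc (0 : ℝ) 1) (ht : t ∈ Icc (0 : ℝ) 1)
    (hb : HasDerivAt β b t) (h : ∀ᶠ s in 𝓝 t, Θ.toFun s x = Ψ.toFun (β s) z) :
    Θ.alphaVelocity t x = b * Ψ.alphaVelocity (β t) z := by
  have h1 := (Ψ.hasMFDerivWithinAt_reparam hβ ht hb z).congr_of_eventuallyEq
    (h.filter_mono nhdsWithin_le_nhds) h.self_of_nhds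
  refine (Θ.alphaVelocity_eq ht h1).trans ?_
  refine (congrArg (fun q : N => α.onTangent ⟨q, (b • (Ψ.velocity (β t) z : 𝔼) : 𝔼)⟩)
    h.self_of_nhds).trans ?_
  exact (α.form (Ψ.toFun (β t) z)).map_smul b _

/-- The isotopy which follows first `Ψ` and then `Φ`. -/
def concat (Φ Ψ : α.ContactIsotopy) : α.ContactIsotopy where
  -- `Real.smoothTransition` is 0 up to 0 and 1 from 1 on. So `Ψ` runs during `[0, 1/3]`, `Φ` during
  -- `[2/3, 1]`, and both rest in between.
  toFun t := Φ.toFun (Real.smoothTransition (3 * t - 2)) *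
    Ψ.toFun (Real.smoothTransition (3 * t))
  zero := by
    rw [Real.smoothTransition.zero_of_nonpos (by norm_num),
      Real.smoothTransition.zero_of_nonpos (by norm_num), Φ.zero, Ψ.zero, mul_one]
  contact _ _ := (Φ.contact _ ⟨Real.smoothTransition.nonneg _, Real.smoothTransition.le_one _⟩).mul
    (Ψ.contact _ ⟨Real.smoothTransition.nonneg _, Real.smoothTransition.le_one _⟩)
  smooth := by
    have h1 : ContMDiff (𝓘(ℝ).prod (𝓘N)) 𝓘(ℝ) ∞
        (fun p : ℝ × N => Real.smoothTransition (3 * p.1 - 2)) :=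
      (Real.smoothTransition.contDiff.comp (f := fun t : ℝ => 3 * t - 2)
        (by fun_prop)).contMDiff.comp contMDiff_fst
    have h2 : ContMDiff (𝓘(ℝ).prod (𝓘N)) 𝓘(ℝ) ∞
        (fun p : ℝ × N => Real.smoothTransition (3 * p.1)) :=
      (Real.smoothTransition.contDiff.comp (f := fun t : ℝ => 3 * t)
        (by fun_prop)).contMDiff.comp contMDiff_fst
    have hm : ∀ r, Real.smoothTransition r ∈ Icc (0 : ℝ) 1 := fun r =>
      ⟨Real.smoothTransition.nonneg _, Real.smoothTransition.le_one _⟩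
    exact Φ.smooth.comp (h1.contMDiffOn.prodMk
      (Ψ.smooth.comp (h2.prodMk contMDiff_snd).contMDiffOn fun p _ => ⟨hm _, mem_univ _⟩))
      fun p _ => ⟨hm _, mem_univ _⟩

theorem concat_one (Φ Ψ : α.ContactIsotopy) :
    (Φ.concat Ψ).toFun 1 = Φ.toFun 1 * Ψ.toFun 1 := by
  change Φ.toFun _ * Ψ.toFun _ = _
  rw [Real.smoothTransition.one_of_one_le (by norm_num),
    Real.smoothTransition.one_of_one_le (by norm_num)]

/-- Near a time `t ≤ 1/2` the factor `Φ` is the identity, and near `t > 1/2` the factor `Ψ` has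
reached its end. Only one factor moves, so no conformal factor enters, and the other summand of the
bound is nonnegative. -/
theorem abs_alphaVelocity_concat_le (Φ Ψ : α.ContactIsotopy) {t : ℝ} (ht : t ∈ Icc (0 : ℝ) 1)
    {f g : ℝ → ℝ} (hf : ∀ t ∈ Icc (0 : ℝ) 1, ∀ x, |Φ.alphaVelocity t x| ≤ f t)
    (hg : ∀ t ∈ Icc (0 : ℝ) 1, ∀ x, |Ψ.alphaVelocity t x| ≤ g t) (x : N) :
    |(Φ.concat Ψ).alphaVelocity t x| ≤
      f (Real.smoothTransition (3 * t - 2)) *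
          deriv (fun s => Real.smoothTransition (3 * s - 2)) t +
        g (Real.smoothTransition (3 * t)) * deriv (fun s => Real.smoothTransition (3 * s)) t := by
  have hm : ∀ r, Real.smoothTransition r ∈ Icc (0 : ℝ) 1 := fun r =>
    ⟨Real.smoothTransition.nonneg _, Real.smoothTransition.le_one _⟩
  have hd1 : Differentiable ℝ (fun s => Real.smoothTransition (3 * s - 2)) :=
    (Real.smoothTransition.contDiff (n := 1).comp (f := fun t : ℝ => 3 * t - 2)
      (by fun_prop)).differentiable (by simp)
  have hd2 : Differentiable ℝ (fun s => Real.smoothTransition (3 * s)) :=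
    (Real.smoothTransition.contDiff (n := 1).comp (f := fun t : ℝ => 3 * t)
      (by fun_prop)).differentiable (by simp)
  have hn1 : 0 ≤ deriv (fun s => Real.smoothTransition (3 * s - 2)) t :=
    Monotone.deriv_nonneg fun a b h => Real.smoothTransition.monotone (by linarith)
  have hn2 : 0 ≤ deriv (fun s => Real.smoothTransition (3 * s)) t :=
    Monotone.deriv_nonneg fun a b h => Real.smoothTransition.monotone (by linarith)
  have hfx := hf _ (hm (3 * t - 2))
  have hgx := hg _ (hm (3 * t))
  have hf0 := mul_nonneg ((abs_nonneg _).trans (hfx x)) hn1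
  have hg0 := mul_nonneg ((abs_nonneg _).trans (hgx x)) hn2
  rcases le_or_gt t (1 / 2) with h | h
  · have he : ∀ᶠ s in 𝓝 t, (Φ.concat Ψ).toFun s x =
        Ψ.toFun (Real.smoothTransition (3 * s)) x := by
      filter_upwards [Iio_mem_nhds (show t < 2 / 3 by linarith)] with s hs
      change Φ.toFun _ (Ψ.toFun _ x) = _
      rw [Real.smoothTransition.zero_of_nonpos (x := 3 * s - 2) (by linarith [mem_Iio.1 hs]),
        Φ.zero, diffeo_one_apply]
    rw [alphaVelocity_eq_of_reparam _ Ψ (fun s _ => hm (3 * s)) ht (hd2 t).hasDerivAt he,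
      abs_mul, abs_of_nonneg hn2, mul_comm]
    have := mul_le_mul_of_nonneg_right (hgx x) hn2
    linarith
  · have he : ∀ᶠ s in 𝓝 t, (Φ.concat Ψ).toFun s x =
        Φ.toFun (Real.smoothTransition (3 * s - 2)) (Ψ.toFun 1 x) := by
      filter_upwards [Ioi_mem_nhds (show 1 / 3 < t by linarith)] with s hs
      change Φ.toFun _ (Ψ.toFun _ x) = _
      rw [Real.smoothTransition.one_of_one_le (x := 3 * s) (by linarith [mem_Ioi.1 hs])]
    rw [alphaVelocity_eq_of_reparam _ Φ (fun s _ => hm (3 * s - 2)) ht (hd1 t).hasDerivAt he,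
      abs_mul, abs_of_nonneg hn1, mul_comm]
    have := mul_le_mul_of_nonneg_right (hfx (Ψ.toFun 1 x)) hn1
    linarith

end ContactIsotopy

variable [CompactSpace N]

theorem hoferEnergy_one_nonpos [Nonempty N] : α.hoferEnergy 1 ≤ 0 := by
  have h := hoferEnergy_le (ψ := (1 : α.contactGroup)) (ContactIsotopy.refl α) rfl
    (g := fun _ => 0) continuousOn_const
    fun t ht x => (abs_eq_zero.2 (ContactIsotopy.alphaVelocity_refl ht x)).le
  simpa using h

/-- Substitution: the integral of a majorant is unchanged by reparametrising time. -/
theorem continuous_and_integral_comp_mul_deriv {g : ℝ → ℝ} (hg : ContinuousOn g (Icc 0 1))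
    {β : ℝ → ℝ} (hβ : ContDiff ℝ 1 β) (hm : ∀ t, β t ∈ Icc (0 : ℝ) 1) (h0 : β 0 = 0) (h1 : β 1 = 1) :
    Continuous (fun t => g (β t) * deriv β t) ∧
      ∫ t in (0 : ℝ)..1, g (β t) * deriv β t = ∫ t in (0 : ℝ)..1, g t := by
  have hc := hβ.continuous_deriv le_rfl
  have hgc : Continuous (fun t => g (β t)) := hg.comp_continuous hβ.continuous hm
  refine ⟨hgc.mul hc, ?_⟩
  have := intervalIntegral.integral_comp_mul_deriv' (a := 0) (b := 1) (f := β) (f' := deriv β)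
    (g := g) (fun x _ => (hβ.differentiable (by simp) x).hasDerivAt) hc.continuousOn
    (hg.mono (image_subset_iff.2 fun t _ => hm t))
  rw [h0, h1] at this
  exact this

/-- Near-optimal isotopies are run one after the other; this is the triangle inequality for `d_α`.
-/
theorem hoferEnergy_mul_le [Nonempty N] (φ ψ : α.contactGroup) :
    α.hoferEnergy (φ * ψ) ≤ α.hoferEnergy φ + α.hoferEnergy ψ := by
  refine le_of_forall_pos_lt_add fun ε hε => ?_
  obtain ⟨Φ, hΦ, f, hfc, hfi, hf⟩ := exists_isotopy_of_hoferEnergy_lt (ψ := φ)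
    (lt_add_of_pos_right _ (half_pos hε))
  obtain ⟨Ψ, hΨ, g, hgc, hgi, hg⟩ := exists_isotopy_of_hoferEnergy_lt (ψ := ψ)
    (lt_add_of_pos_right _ (half_pos hε))
  have hm : ∀ r, Real.smoothTransition r ∈ Icc (0 : ℝ) 1 := fun r =>
    ⟨Real.smoothTransition.nonneg _, Real.smoothTransition.le_one _⟩
  obtain ⟨c1, i1⟩ := continuous_and_integral_comp_mul_deriv hfc
    (β := fun s => Real.smoothTransition (3 * s - 2))
    (Real.smoothTransition.contDiff.comp (f := fun t : ℝ => 3 * t - 2) (by fun_prop))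
    (fun _ => hm _) (Real.smoothTransition.zero_of_nonpos (by norm_num))
    (Real.smoothTransition.one_of_one_le (by norm_num))
  obtain ⟨c2, i2⟩ := continuous_and_integral_comp_mul_deriv hgc
    (β := fun s => Real.smoothTransition (3 * s))
    (Real.smoothTransition.contDiff.comp (f := fun t : ℝ => 3 * t) (by fun_prop))
    (fun _ => hm _) (Real.smoothTransition.zero_of_nonpos (by norm_num))
    (Real.smoothTransition.one_of_one_le (by norm_num))
  have h := hoferEnergy_le (ψ := φ * ψ) (Φ.concat Ψ)
    ((Φ.concat_one Ψ).trans (congrArg₂ (· * ·) hΦ hΨ)) (c1.add c2).continuousOn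
    fun t ht x => Φ.abs_alphaVelocity_concat_le Ψ ht hf hg x
  have hi := intervalIntegral.integral_add (c1.intervalIntegrable (μ := MeasureTheory.volume) 0 1)
    (c2.intervalIntegrable 0 1)
  rw [i1, i2] at hi
  replace h := h.trans_eq hi
  linarith

/-- Open sets are defined by containing balls, so openness of the balls themselves needs the
triangle inequality, applied to `χψ⁻¹ = (χφ⁻¹)(φψ⁻¹)`. -/
theorem isOpen_hoferBall [Nonempty N] (ψ : α.contactGroup) (ε : ℝ) :
    IsOpen[α.hoferTopology] {χ | α.hoferDist ψ χ < ε} := by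
  intro φ hφ
  refine ⟨ε - α.hoferDist ψ φ, sub_pos.2 hφ, fun χ hχ => ?_⟩
  have h := hoferEnergy_mul_le (χ * φ⁻¹) (φ * ψ⁻¹)
  rw [show χ * φ⁻¹ * (φ * ψ⁻¹) = χ * ψ⁻¹ by group] at h
  exact (h.trans_lt (add_lt_add_left hχ _)).trans_eq (sub_add_cancel ε _)

end Operations

/-! ### Twisting by the Reeb flow and the two implications -/

section Twist

variable [CompactSpace N] [T2Space N] (α : ContactForm n N)

theorem reebDiffeo_zero : α.reebDiffeo 0 = 1 := Diffeomorph.ext α.reebFlow_zero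

theorem reebDiffeo_neg_mul (t : ℝ) : α.reebDiffeo (-t) * α.reebDiffeo t = 1 :=
  Diffeomorph.ext (α.reebDiffeo t).left_inv

/-- The reversed isotopy `Ψ`, composed with a contactomorphism on the right and moved by the Reeb
flow on the left. -/
def reebTwist {C : ℝ → ℝ} (hC : ContDiff ℝ ∞ C) (Ψ : α.ContactIsotopy)
    {g : Diffeomorph (𝓘N) (𝓘N) N N ∞} (hg : α.IsContactomorphism g)
    (h0 : α.reebDiffeo (C 0) * (Ψ.toFun 1 * g) = 1) : α.ContactIsotopy where
  -- Reversing time puts the end point of `Ψ` at `s = 0`, where `h0` cancels it, and the identity at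
  -- `s = 1`, leaving the Reeb map times `g`.
  toFun s := α.reebDiffeo (C s) * (Ψ.toFun (1 - s) * g)
  zero := by rw [sub_zero, h0]
  contact t ht := (α.isContactomorphism_reebDiffeo _).mul
    ((Ψ.contact _ (by constructor <;> linarith [ht.1, ht.2])).mul hg)
  smooth := by
    have h1 : ContMDiff (𝓘(ℝ).prod (𝓘N)) 𝓘(ℝ) ∞ (fun p : ℝ × N => C p.1) :=
      hC.contMDiff.comp contMDiff_fst
    have h2 : ContMDiff (𝓘(ℝ).prod (𝓘N)) 𝓘(ℝ) ∞ (fun p : ℝ × N => 1 - p.1) :=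
      ((contDiff_const (c := (1 : ℝ))).sub contDiff_id).contMDiff.comp contMDiff_fst
    have h3 : ContMDiffOn (𝓘(ℝ).prod (𝓘N)) (𝓘N) ∞ (fun p : ℝ × N => Ψ.toFun (1 - p.1) (g p.2))
        (Icc (0 : ℝ) 1 ×ˢ univ) :=
      Ψ.smooth.comp (h2.prodMk (g.contMDiff.comp contMDiff_snd)).contMDiffOn
        fun p hp => ⟨by constructor <;> linarith [hp.1.1, hp.1.2], mem_univ _⟩
    exact α.contMDiff_reebFlow.comp_contMDiffOn (h1.contMDiffOn.prodMk h3)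

theorem reebTwist_one {C : ℝ → ℝ} (hC : ContDiff ℝ ∞ C) (Ψ : α.ContactIsotopy)
    {g : Diffeomorph (𝓘N) (𝓘N) N N ∞} (hg : α.IsContactomorphism g)
    (h0 : α.reebDiffeo (C 0) * (Ψ.toFun 1 * g) = 1) :
    (α.reebTwist hC Ψ hg h0).toFun 1 = α.reebDiffeo (C 1) * g := by
  change _ * (Ψ.toFun (1 - 1) * g) = _
  rw [sub_self, Ψ.zero, one_mul]

/-- Right composition with `g` only relabels the starting point, time reversal changes the sign, and
the Reeb flow adds `C'`. -/
theorem alphaVelocity_reebTwist {C : ℝ → ℝ} (hC : ContDiff ℝ ∞ C) (Ψ : α.ContactIsotopy)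
    {g : Diffeomorph (𝓘N) (𝓘N) N N ∞} (hg : α.IsContactomorphism g)
    (h0 : α.reebDiffeo (C 0) * (Ψ.toFun 1 * g) = 1) {c t : ℝ} (ht : t ∈ Icc (0 : ℝ) 1)
    (hc : HasDerivAt C c t) (x : N) :
    (α.reebTwist hC Ψ hg h0).alphaVelocity t x = c - Ψ.alphaVelocity (1 - t) (g x) := by
  have h1 := Ψ.hasMFDerivWithinAt_reparam (β := fun s => 1 - s) (b := -1) (t := t)
    (fun s hs => by constructor <;> linarith [hs.1, hs.2]) ht
    ((hasDerivAt_id t).const_sub 1) (g x)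
  refine (α.onTangent_reebFlow_comp ht h1 hc).trans ?_
  rw [sub_eq_add_neg]
  refine congrArg (c + ·) ?_
  refine ((α.form (Ψ.toFun (1 - t) (g x))).map_smul (-1 : ℝ) _).trans ?_
  exact neg_one_mul (Ψ.alphaVelocity (1 - t) (g x))

theorem reebDiffeo_mem_contactGroup (T : ℝ) : α.reebDiffeo T ∈ α.contactGroup := by
  have hC : ContDiff ℝ ∞ (fun s : ℝ => T * s) := contDiff_const.mul contDiff_id
  refine ⟨α.reebTwist hC (ContactIsotopy.refl α) α.isContactomorphism_one ?_, ?_⟩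
  · rw [mul_zero, reebDiffeo_zero]
    rfl
  · rw [reebTwist_one, mul_one, mul_one]

theorem mem_reebGroup_iff {φ : α.contactGroup} :
    φ ∈ α.reebGroup ↔ ∃ T, φ.1 = α.reebDiffeo T := by
  constructor
  · rintro ⟨T, hT⟩
    refine ⟨T, Diffeomorph.ext fun x => ?_⟩
    obtain ⟨γ, hγ, h0, h1⟩ := hT x
    rw [← h1, α.eq_reebFlow hγ, h0, reebDiffeo_apply]
  · rintro ⟨T, hT⟩
    refine ⟨T, fun x => ⟨fun t => α.reebFlow t x, α.isMIntegralCurve_reebFlow x,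
      α.reebFlow_zero x, ?_⟩⟩
    rw [hT, reebDiffeo_apply]

variable {α}

theorem continuousOn_and_integral_comp_one_sub {g : ℝ → ℝ} (hg : ContinuousOn g (Icc 0 1)) :
    ContinuousOn (fun t => g (1 - t)) (Icc 0 1) ∧
      ∫ t in (0 : ℝ)..1, g (1 - t) = ∫ t in (0 : ℝ)..1, g t := by
  refine ⟨hg.comp (by fun_prop) fun t ht => ?_, ?_⟩
  · constructor <;> linarith [ht.1, ht.2]
  · rw [intervalIntegral.integral_comp_sub_left g 1, sub_self, sub_zero]

variable [Nonempty N]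

/-- A near-optimal isotopy is normalised by subtracting, up to a small error, its Hamiltonian along
one orbit; the accumulated Reeb time gives the nearby element of the Reeb group. -/
theorem mem_closure_of_oscEnergy_eq_zero {ψ : α.contactGroup} (h : α.oscEnergy ψ = 0) :
    ψ ∈ closure[α.hoferTopology] α.reebGroup := by
  rw [@mem_closure_iff _ α.hoferTopology]
  intro U hU hψ
  obtain ⟨ε, hε, hball⟩ := hU ψ hψ
  obtain ⟨Ψ, hΨ, g, hgc, hgi, hg⟩ := exists_isotopy_of_oscEnergy_lt (ψ := ψ)
    (h.trans_lt (half_pos hε))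
  obtain ⟨x₀⟩ := ‹Nonempty N›
  have hK : ContinuousOn (fun t => Ψ.alphaVelocity t x₀) (Icc 0 1) :=
    Ψ.continuousOn_alphaVelocity.comp (f := fun t : ℝ => (t, x₀)) (by fun_prop)
      fun t ht => ⟨ht, mem_univ _⟩
  -- The twist needs a Reeb time smooth on all of `ℝ`, whereas the Hamiltonian along the orbit is
  -- known to be continuous on `[0, 1]`. A polynomial within `ε / 2` serves instead.
  obtain ⟨p, hp⟩ := exists_polynomial_near_of_continuousOn 0 1 _ hK (ε / 2) (half_pos hε)
  set P : ℝ → ℝ := fun t => ∫ s in (0 : ℝ)..t, p.eval s with hP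
  have hPd : ∀ t, HasDerivAt P (p.eval t) t := fun t =>
    p.continuous.integral_hasStrictDerivAt 0 t |>.hasDerivAt
  have hPs : ContDiff ℝ ∞ P := by
    refine contDiff_infty_iff_deriv.2 ⟨fun t => (hPd t).differentiableAt, ?_⟩
    rw [show deriv P = fun t => p.eval t from funext fun t => (hPd t).deriv]
    exact p.contDiff_aeval (𝕜 := ℝ) ∞
  have hC : ContDiff ℝ ∞ (fun s => P 1 - P (1 - s)) :=
    contDiff_const.sub (hPs.comp (contDiff_const.sub contDiff_id))
  have hC0 : P 1 - P (1 - 0) = 0 := by rw [sub_zero, sub_self]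
  have hC1 : P 1 - P (1 - 1) = P 1 := by
    rw [sub_self, hP]
    simp
  have hCd : ∀ t, HasDerivAt (fun s => P 1 - P (1 - s)) (p.eval (1 - t)) t := fun t => by
    have h1 := ((hPd (1 - t)).comp t ((hasDerivAt_id t).const_sub 1)).const_sub (P 1)
    simpa using h1
  refine ⟨⟨α.reebDiffeo (P 1), α.reebDiffeo_mem_contactGroup _⟩, hball _ ?_,
    α.mem_reebGroup_iff.2 ⟨_, rfl⟩⟩
  have h0 : α.reebDiffeo (P 1 - P (1 - 0)) * (Ψ.toFun 1 * ψ.1⁻¹) = 1 := by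
    rw [hC0, reebDiffeo_zero, hΨ, mul_inv_cancel, one_mul]
  obtain ⟨hgc', hgi'⟩ := continuousOn_and_integral_comp_one_sub hgc
  have key := hoferEnergy_le
    (ψ := (⟨α.reebDiffeo (P 1), α.reebDiffeo_mem_contactGroup _⟩ : α.contactGroup) * ψ⁻¹)
    (α.reebTwist hC Ψ (isContactomorphism_of_mem ψ.2).inv h0)
    ((α.reebTwist_one _ _ _ _).trans (by rw [hC1]; rfl))
    -- The polynomial error is at most `ε / 2`, and the deviation from the value at `x₀` is at most
    -- the oscillation, whose integral is below `ε / 2`.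
    (g := fun t => ε / 2 + g (1 - t)) (continuousOn_const.add hgc') fun t ht x => by
      have ht' : 1 - t ∈ Icc (0 : ℝ) 1 := by constructor <;> linarith [ht.1, ht.2]
      rw [α.alphaVelocity_reebTwist hC Ψ _ h0 ht (hCd t)]
      have h1 := abs_lt.1 (hp _ ht')
      have h2 := hg _ ht' (ψ.1⁻¹ x) x₀
      have h3 := hg _ ht' x₀ (ψ.1⁻¹ x)
      rw [abs_le]
      constructor <;> linarith [h1.1, h1.2]
  refine key.trans_lt ?_
  rw [intervalIntegral.integral_add intervalIntegrable_const
    (hgc'.intervalIntegrable_of_Icc zero_le_one), hgi', intervalIntegral.integral_const]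
  simp only [sub_zero, one_smul]
  linarith

/-- A cheap path to `φψ⁻¹`, with `φ` a Reeb map, is reversed and twisted into a path to `ψ` whose
Hamiltonian is nearly constant in space. -/
theorem oscEnergy_eq_zero_of_mem_closure {ψ : α.contactGroup}
    (h : ψ ∈ closure[α.hoferTopology] α.reebGroup) : α.oscEnergy ψ = 0 := by
  refine le_antisymm (le_of_forall_pos_le_add fun ε hε => ?_) (oscEnergy_nonneg ψ)
  rw [@mem_closure_iff _ α.hoferTopology] at h
  obtain ⟨φ, hφψ, hφ⟩ := h _ (isOpen_hoferBall ψ (ε / 2)) (by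
    change α.hoferEnergy (ψ * ψ⁻¹) < _
    rw [mul_inv_cancel]
    exact hoferEnergy_one_nonpos.trans_lt (half_pos hε))
  obtain ⟨T, hT⟩ := α.mem_reebGroup_iff.1 hφ
  obtain ⟨X, hX, g, hgc, hgi, hg⟩ := exists_isotopy_of_hoferEnergy_lt
    (show α.hoferEnergy (φ * ψ⁻¹) < ε / 2 from hφψ)
  -- The Reeb time starts at `-T`, undoing `φ`, and ends at 0, so that the path ends exactly at `ψ`.
  have hC : ContDiff ℝ ∞ (fun s : ℝ => T * s - T) :=
    (contDiff_const.mul contDiff_id).sub contDiff_const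
  have hCd : ∀ t, HasDerivAt (fun s : ℝ => T * s - T) T t := fun t => by
    simpa using ((hasDerivAt_id t).const_mul T).sub_const T
  have h0 : α.reebDiffeo (T * 0 - T) * (X.toFun 1 * ψ.1) = 1 := by
    rw [mul_zero, zero_sub, hX]
    change _ * (φ.1 * ψ.1⁻¹ * ψ.1) = 1
    rw [inv_mul_cancel_right, hT, reebDiffeo_neg_mul]
  obtain ⟨hgc', hgi'⟩ := continuousOn_and_integral_comp_one_sub hgc
  have key := oscEnergy_le (ψ := ψ) (α.reebTwist hC X (isContactomorphism_of_mem ψ.2) h0)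
    ((α.reebTwist_one _ _ _ _).trans (by rw [mul_one, sub_self, reebDiffeo_zero, one_mul]))
    -- The constant `T` cancels in the difference of two values, leaving two terms each bounded by
    -- `g (1 - t)`.
    (g := fun t => 2 * g (1 - t)) (continuousOn_const.mul hgc') fun t ht x y => by
      have ht' : 1 - t ∈ Icc (0 : ℝ) 1 := by constructor <;> linarith [ht.1, ht.2]
      rw [α.alphaVelocity_reebTwist hC X _ h0 ht (hCd t),
        α.alphaVelocity_reebTwist hC X _ h0 ht (hCd t)]
      have h1 := abs_le.1 (hg _ ht' (ψ.1 x))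
      have h2 := abs_le.1 (hg _ ht' (ψ.1 y))
      linarith [h1.1, h2.2]
  refine key.trans ?_
  rw [intervalIntegral.integral_const_mul, hgi']
  linarith

end Twist

end ContactForm

end

theorem mainTheorem12 (n : ℕ) (N : Type*) [TopologicalSpace N] [T2Space N] [CompactSpace N]
    [ConnectedSpace N] [ChartedSpace (EuclideanSpace ℝ (Fin (2 * n + 1))) N]
    [IsManifold (𝓡 (2 * n + 1)) ∞ N] (α : ContactForm n N) (ψ : α.contactGroup) :
    α.oscEnergy ψ = 0 ↔ ψ ∈ closure[α.hoferTopology] α.reebGroup :=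
  ⟨ContactForm.mem_closure_of_oscEnergy_eq_zero, ContactForm.oscEnergy_eq_zero_of_mem_closure⟩
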